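/- **Setting.** Let $n\ge 1$ workers (arms) have computation-time distributions $\nu_1,\dots,\nu_n$. Write $X_i\sim\nu_i$, $\mu_i=\mathbb E X_i$ and $\bm\mu=(\mu_1,\dots,\mu_n)$. For a real random variable $Y$ let $\|Y\|_{\psi_1}=\inf\{C>0:\mathbb E\exp(|Y|/C)\le 2\}$. Assume that, for some $\alpha\ge 0$ and every $i$, $X_i>0$ almost surely and $\|X_i-\mu_i\|_{\psi_1}\le\alpha$. Put $\alpha_i=\|X_i\|_{\psi_1}$. For a budget $B\in\mathbb N$ let $\mathcal A=\{\bm a\in\mathbb N^n:\sum_i a_i=B\}$ and $\ell(\bm a,\bm s)=\max_i a_is_i$, and write $\ell(\bm a)=\ell(\bm a,\bm\mu)$. Let $\bar{\bm a}\in\arg\min_{\bm a\in\mathcal A}\ell(\bm a)$, and let $k_i$ be the smallest integer with $(\bar a_i+k_i)\mu_i>\ell(\bar{\bm a})$. **Algorithm (ATA-Empirical with inputs $(B,\eta)$).** In round $k=1,2,\dots$ let $X_{i,k}^{(u)}\sim\nu_i$, $i\in[n]$, $u\in[B]$, be the computation times, all independent over $i,k,u$. Let $K_{i,k}=\sum_{q<k}a_{i,q}$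 be the number of samples of arm $i$ collected before round $k$, and $\hat\mu_{i,k}=\frac1{K_{i,k}}\sum_{q<k}\sum_{u=1}^{a_{i,q}}X_{i,q}^{(u)}$ their empirical mean. Set $$C_{i,k}=2\sqrt{\frac{\ln(2k^2)}{K_{i,k}}}+2\,\frac{\ln(2k^2)}{K_{i,k}},\qquad \hat s_{i,k}=\hat\mu_{i,k}\,(1-\eta C_{i,k})_+,$$ with $\hat s_{i,k}=0$ if $K_{i,k}=0$. Using only the information available before round $k$, which is independent of the computation times of round $k$, the learner plays some $\bm a_k\in\arg\min_{\bm a\in\mathcal A}\ell(\bm a,\hat{\bm s}_k)$, ties being broken in any such way. **Theorem.** There is a numerical constant $c>0$ such that, for all such $n,B,(\nu_i)$, every $\eta\ge\max_i\alpha_i/\mu_i$, every run of ATA-Empirical with inputs $(B,\eta)$, and every number of rounds $K$, the expected regret $\mathcal R_K=\sum_{k=1}^K\mathbb E[\ell(\bm a_k)]-K\,\ell(\bar{\bm a})$ satisfies $$\mathcal R_K\le 2n\max_{i}\{B\mu_i-\ell(\bar{\bm a})\}+c\,\eta^2\sum_{i=1}^n\frac{\mu_i^2(\bar a_i+k_i)(B\mu_i-\ell(\bar{\bm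 a}))}{\big((\bar a_i+k_i)\mu_i-\ell(\bar{\bm a})\big)^2}\,\ln K .$$ -/

import Mathlib

open MeasureTheory ProbabilityTheory
open scoped ENNReal

namespace ATA

/-- The Orlicz norm `‖Y‖_{ψ₁} = inf {C > 0 : 𝔼 exp(|Y|/C) ≤ 2}`; it is `∞` if there is no
such `C`. -/
noncomputable def psiOneNorm {Ω : Type*} [MeasurableSpace Ω] (P : Measure Ω) (Y : Ω → ℝ) : ℝ≥0∞ :=
  ⨅ (C : ℝ) (_ : 0 < C) (_ : ∫⁻ ω, ENNReal.ofReal (Real.exp (|Y ω| / C)) ∂P ≤ 2),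
    ENNReal.ofReal C

/-- The mean `μ i` of the computation time of worker `i`, whose distribution is `ν i`. -/
noncomputable def mean {n : ℕ} (ν : Fin n → Measure ℝ) (i : Fin n) : ℝ := ∫ x, x ∂(ν i)

/-- The modelling assumption: every `ν i` is the distribution of a positive random variable `X_i`
with `‖X_i - μ_i‖_{ψ₁} ≤ α`. -/
structure SubExponentialArms {n : ℕ} (ν : Fin n → Measure ℝ) (α : ℝ) : Prop where
  alpha_nonneg : 0 ≤ α
  isProb : ∀ i, IsProbabilityMeasure (ν i)
  pos : ∀ i, ∀ᵐ x ∂(ν i), 0 < x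
  psiOne_le : ∀ i, psiOneNorm (ν i) (fun x => x - mean ν i) ≤ ENNReal.ofReal α

/-- The action set: vectors of natural numbers with `ℓ¹` norm `B`. -/
def allocations (n B : ℕ) : Set (Fin n → ℕ) := {a | ∑ i, a i = B}

/-- The proxy loss `ℓ(a, s) = max_i a_i s_i`. -/
noncomputable def proxyLoss {n : ℕ} (a : Fin n → ℕ) (s : Fin n → ℝ) : ℝ := ⨆ i, (a i : ℝ) * s i

/-- `a ∈ argmin_{b ∈ 𝒜} ℓ(b, s)`. -/
def IsOptimal {n : ℕ} (B : ℕ) (s : Fin n → ℝ) (a : Fin n → ℕ) : Prop :=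
  a ∈ allocations n B ∧ ∀ b ∈ allocations n B, proxyLoss a s ≤ proxyLoss b s

section Statistics

/- Rounds are numbered from `0`: round `t` below is the round `k = t + 1` of the usual numbering.
`a t ω i` is the number of tasks given to worker `i` in round `t`, and `X i t u ω`, `u : Fin B`, are
the computation times of worker `i` in round `t`, of which those with `u < a t ω i` are used. -/

variable {n B : ℕ} {Ω : Type*}

/-- Number of samples of arm `i` collected before round `t`. -/
def sampleCount (a : ℕ → Ω → Fin n → ℕ) (i : Fin n) (t : ℕ) (ω : Ω) : ℕ :=
  ∑ q ∈ Finset.range t, a q ω i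

/-- Sum of the samples of arm `i` collected before round `t`. -/
noncomputable def sampleSum (X : Fin n → ℕ → Fin B → Ω → ℝ) (a : ℕ → Ω → Fin n → ℕ)
    (i : Fin n) (t : ℕ) (ω : Ω) : ℝ :=
  ∑ q ∈ Finset.range t,
    ∑ u ∈ Finset.univ.filter (fun u : Fin B => (u : ℕ) < a q ω i), X i q u ω

/-- Empirical mean of arm `i` before round `t`; it is `0` if there is no sample yet. -/
noncomputable def empMean (X : Fin n → ℕ → Fin B → Ω → ℝ) (a : ℕ → Ω → Fin n → ℕ)
    (i : Fin n) (t : ℕ) (ω : Ω) : ℝ :=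
  sampleSum X a i t ω / (sampleCount a i t ω : ℝ)

/-- `2 √(ln(2k²)/m) + 2 ln(2k²)/m` with `k = t + 1` and `m` the number of samples of arm `i`
before round `t`. Its value at `m = 0` is irrelevant, since the empirical mean is then `0`. -/
noncomputable def confWidth (a : ℕ → Ω → Fin n → ℕ) (i : Fin n) (t : ℕ) (ω : Ω) : ℝ :=
  2 * √(Real.log (2 * ((t : ℝ) + 1) ^ 2) / (sampleCount a i t ω : ℝ))
    + 2 * (Real.log (2 * ((t : ℝ) + 1) ^ 2) / (sampleCount a i t ω : ℝ))

/-- The multiplicative lower confidence bound; it is `0` for an arm without samples. -/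
noncomputable def lcb (η : ℝ) (X : Fin n → ℕ → Fin B → Ω → ℝ) (a : ℕ → Ω → Fin n → ℕ)
    (t : ℕ) (ω : Ω) (i : Fin n) : ℝ :=
  empMean X a i t ω * max (1 - η * confWidth a i t ω) 0

end Statistics

/-- The sampling model: the computation times `X i t u` (`u : Fin B`) are independent, `X i t u`
has distribution `ν i`, and `ℱ t` is the information available before round `t`: it contains the
computation times of the earlier rounds (and possibly internal randomness of the learner) and is
independent of the computation times of round `t`. -/
structure IsSampling {n B : ℕ} {Ω : Type*} {mΩ : MeasurableSpace Ω} (P : Measure Ω)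
    (ν : Fin n → Measure ℝ) (ℱ : Filtration ℕ mΩ) (X : Fin n → ℕ → Fin B → Ω → ℝ) : Prop where
  map_eq : ∀ i t u, P.map (X i t u) = ν i
  indep : iIndepFun (fun p : Fin n × ℕ × Fin B => X p.1 p.2.1 p.2.2) P
  measurable : ∀ i t u, Measurable[ℱ (t + 1)] (X i t u)
  indep_past : ∀ t, Indep (ℱ t)
    (MeasurableSpace.comap (fun ω (p : Fin n × Fin B) => X p.1 t p.2 ω) inferInstance) P

/-- `a` is the sequence of allocations chosen by ATA-Empirical with inputs `(B, η)`: the allocation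
of round `t` depends only on the information available before round `t`, and it minimizes the proxy
loss at the current vector of lower confidence bounds (ties may be broken in any way). -/
structure IsATAEmpirical {n B : ℕ} {Ω : Type*} {mΩ : MeasurableSpace Ω} (η : ℝ)
    (ℱ : Filtration ℕ mΩ) (X : Fin n → ℕ → Fin B → Ω → ℝ) (a : ℕ → Ω → Fin n → ℕ) : Prop where
  predictable : ∀ t, Measurable[ℱ t] (a t)
  optimal : ∀ t ω, IsOptimal B (lcb η X a t ω) (a t ω)

/-- Expected cumulative regret of the proxy loss after `K` rounds, with respect to `abar`. -/
noncomputable def regret {n : ℕ} {Ω : Type*} [MeasurableSpace Ω] (P : Measure Ω) (μ : Fin n → ℝ)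
    (a : ℕ → Ω → Fin n → ℕ) (abar : Fin n → ℕ) (K : ℕ) : ℝ :=
  (∑ t ∈ Finset.range K, ∫ ω, proxyLoss (a t ω) μ ∂P) - (K : ℝ) * proxyLoss abar μ

end ATA

/-!
# Regret of ATA-Empirical

Measure the computation times of an arm in units of `η μ`, so that `W = X / (η μ)` satisfies
`𝔼 exp W ≤ 2` and `𝔼 W = 1 / η ≤ 1`. The confidence bounds then say that the empirical mean of `W`
is within the confidence width of its expectation.

**Regret without failures.** If no confidence bound fails in a round, every lower confidence bound
is at most the mean, so the chosen allocation has estimated loss at most `ℓ(ā)`. If its true loss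
is larger, then the arm `i` attaining it has received at least `N = ā_i + k_i` tasks although
`N ŝ_i ≤ ℓ(ā) < N μ_i`. This forces the confidence width to be large, so that arm `i` has at most
`M = 64 η² μ_i² N² log(2K²) / (N μ_i - ℓ(ā))²` samples (`sample_le_of_lcb_le`). Each such round
adds `N` samples, hence there are at most `M / N + 1 ≤ 2 M / N` of them (`mul_card_filter_le`), and
each costs at most `B μ_i - ℓ(ā)`.

**Failures.** A round with a failure costs at most `max_i (B μ_i - ℓ(ā))`, so the failure
probabilities of each arm in each direction have to sum to at most `1` over the rounds. The sample
sizes are chosen adaptively and range up to `B` times the number of rounds, so a union bound over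
them is not affordable. Instead, with `K_t` samples and centred sum `S_t` before round `t`, consider
the potential `Φ_t = exp (l S_t - (4/5) l² K_t)`, whose tilt `l` is of order `√(L / K_t)`, capped at
`1/4`, and so changes with the number of samples. On `[0, 1/4]` the logarithmic moment generating
function of the noise is at most `(2/5) l²` (`SubExponentialArms.lintegral_exp_mul_le`). One round
therefore takes `Φ` in expectation to at most `max(Φ, 1)`, whatever the number of new samples
(`potential_step`). Hence `𝔼 Φ_t ≤ t`, while `Φ_t ≥ exp (5 L / 4)` when a bound of level `L` fails
(`exp_le_potential`). For `L = log(2k²)`, `k = t + 1`, the failure probability is at most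
`t (2k²)^(-5/4) ≤ 1/√t - 1/√(t+1)`, and these bounds telescope.
-/

namespace ATA


/-! ### Exponential inequalities -/

/-- With `w = exp (x / 4) - 1` and `log (1 + w) ≥ 2 w / (w + 2)` this is a polynomial inequality. -/
lemma exp_quarter_sub_le {x : ℝ} (hx : 0 ≤ x) :
    Real.exp (x / 4) - 1 - x / 4 ≤ (1 / 40) * (Real.exp x - 1) := by
  obtain ⟨w, hw0, hw⟩ : ∃ w : ℝ, 0 ≤ w ∧ Real.exp (x / 4) = 1 + w :=
    ⟨Real.exp (x / 4) - 1, by linarith [Real.add_one_le_exp (x / 4)], by ring⟩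
  have hlog : 2 * w / (w + 2) ≤ x / 4 := by
    simpa [← hw] using Real.le_log_one_add_of_nonneg hw0
  have hpow : Real.exp x = (1 + w) ^ 4 := by
    rw [← hw, ← Real.exp_nat_mul]; congr 1; push_cast; ring
  rw [hw, hpow]
  have key : w - 2 * w / (w + 2) ≤ (1 / 40) * ((1 + w) ^ 4 - 1) := by
    have h2 : 0 < w + 2 := by linarith
    have hid : (1 / 40) * ((1 + w) ^ 4 - 1) - (w - 2 * w / (w + 2))
        = w * ((w ^ 2 + 2 * w + 2) * (w + 2) ^ 2 - 40 * w) / (40 * (w + 2)) := by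
      field_simp; ring
    have hpoly : 0 ≤ (w ^ 2 + 2 * w + 2) * (w + 2) ^ 2 - 40 * w := by
      -- the left side has a single, small positive minimum, near `w = 0.595`
      nlinarith [sq_nonneg (w ^ 2 + 3 * w - 2.151), sq_nonneg (w - 0.595)]
    have : 0 ≤ w * ((w ^ 2 + 2 * w + 2) * (w + 2) ^ 2 - 40 * w) / (40 * (w + 2)) := by
      positivity
    linarith
  linarith

/-- Comparison of the power series term by term. -/
lemma exp_mul_sub_le {r y : ℝ} (hr0 : 0 ≤ r) (hr1 : r ≤ 1) (hy : 0 ≤ y) :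
    Real.exp (r * y) - 1 - r * y ≤ r ^ 2 * (Real.exp y - 1 - y) := by
  have h (z : ℝ) : HasSum (fun p : ℕ => z ^ (p + 2) / (p + 2).factorial)
      (Real.exp z - 1 - z) := by
    have h0 : HasSum (fun p : ℕ => z ^ p / p.factorial) (Real.exp z) := by
      rw [Real.exp_eq_exp_ℝ]; exact NormedSpace.expSeries_div_hasSum_exp z
    have := (hasSum_nat_add_iff' 2).2 h0
    simpa [Finset.sum_range_succ, sub_sub] using this
  refine hasSum_le (fun p => ?_) (h (r * y)) ((h y).mul_left (r ^ 2))
  rw [mul_pow, ← mul_div_assoc, pow_add r]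
  gcongr
  nlinarith [pow_le_one₀ hr0 hr1 (n := p), sq_nonneg r]

/-- The constant `2/5` is what makes the failure probabilities summable later on: with the simpler
constant `1/2` on `[0, 1/2]` the bounds obtained for the rounds would have a divergent sum. -/
lemma exp_mul_le {l x : ℝ} (hl0 : 0 ≤ l) (hl : l ≤ 1 / 4) (hx : 0 ≤ x) :
    Real.exp (l * x) ≤ 1 + l * x + 2 / 5 * l ^ 2 * (Real.exp x - 1) := by
  have h1 := exp_mul_sub_le (r := 4 * l) (y := x / 4) (by linarith) (by linarith) (by linarith)
  have h2 := exp_quarter_sub_le hx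
  rw [show 4 * l * (x / 4) = l * x by ring] at h1
  nlinarith [sq_nonneg l]

lemma exp_neg_mul_le {l x : ℝ} (hl0 : 0 ≤ l) (hx : 0 ≤ x) :
    Real.exp (-(l * x)) ≤ 1 - l * x + 2 / 5 * l ^ 2 * (Real.exp x - 1) := by
  have hy : 0 ≤ l * x := mul_nonneg hl0 hx
  have h1 : Real.exp (-(l * x)) ≤ 1 - l * x + (l * x) ^ 2 / 2 := by
    rw [Real.exp_neg, inv_le_comm₀ (Real.exp_pos _) (by nlinarith [sq_nonneg (l * x - 1)])]
    refine le_trans ?_ (Real.quadratic_le_exp_of_nonneg hy)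
    rw [inv_le_iff_one_le_mul₀ (by nlinarith [sq_nonneg (l * x - 1)])]
    nlinarith [sq_nonneg ((l * x) ^ 2)]
  have h2 : x ^ 2 / 2 ≤ 2 / 5 * (Real.exp x - 1) := by
    have := Real.sum_le_exp_of_nonneg hx 4
    simp [Finset.sum_range_succ, Nat.factorial] at this
    nlinarith [mul_nonneg hx (sq_nonneg (x - 9 / 4))]
  nlinarith [sq_nonneg l]


/-! ### Orlicz norms and moment generating functions -/

section Orlicz

variable {Ω : Type*} [MeasurableSpace Ω] {P : Measure Ω} {Y : Ω → ℝ}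

lemma lintegral_exp_le_two_of_psiOneNorm_lt {C : ℝ} (h : psiOneNorm P Y < ENNReal.ofReal C) :
    ∫⁻ ω, ENNReal.ofReal (Real.exp (|Y ω| / C)) ∂P ≤ 2 := by
  simp only [psiOneNorm, iInf_lt_iff] at h
  obtain ⟨C', hC', hle, hlt⟩ := h
  have hCC : C' < C := (ENNReal.ofReal_lt_ofReal_iff_of_nonneg hC'.le).1 hlt
  refine le_trans (lintegral_mono fun ω => ?_) hle
  gcongr

/-- The infimum in the definition of the Orlicz norm is attained (by Fatou's lemma). -/
lemma lintegral_exp_le_two_of_psiOneNorm_le (hY : Measurable Y) {C : ℝ} (hC : 0 < C)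
    (h : psiOneNorm P Y ≤ ENNReal.ofReal C) :
    ∫⁻ ω, ENNReal.ofReal (Real.exp (|Y ω| / C)) ∂P ≤ 2 := by
  have hlim : Filter.Tendsto (fun k : ℕ => C + 1 / ((k : ℝ) + 1)) Filter.atTop (nhds C) := by
    simpa using tendsto_one_div_add_atTop_nhds_zero_nat.const_add C
  calc ∫⁻ ω, ENNReal.ofReal (Real.exp (|Y ω| / C)) ∂P
      = ∫⁻ ω, Filter.liminf (fun k : ℕ =>
          ENNReal.ofReal (Real.exp (|Y ω| / (C + 1 / ((k : ℝ) + 1))))) Filter.atTop ∂P := by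
        refine lintegral_congr fun ω => (Filter.Tendsto.liminf_eq ?_).symm
        exact ENNReal.tendsto_ofReal ((Real.continuous_exp.tendsto _).comp
          (tendsto_const_nhds.div hlim hC.ne'))
    _ ≤ Filter.liminf (fun k : ℕ => ∫⁻ ω,
          ENNReal.ofReal (Real.exp (|Y ω| / (C + 1 / ((k : ℝ) + 1)))) ∂P) Filter.atTop :=
        lintegral_liminf_le fun k => by fun_prop
    _ ≤ 2 := by
        refine Filter.liminf_le_of_frequently_le' (Filter.Frequently.of_forall fun k => ?_)
        refine lintegral_exp_le_two_of_psiOneNorm_lt (h.trans_lt ?_)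
        have : 0 < 1 / ((k : ℝ) + 1) := by positivity
        exact (ENNReal.ofReal_lt_ofReal_iff (by linarith)).2 (by linarith)

lemma integrable_exp_of_lintegral_le_two (hY : Measurable Y) {C : ℝ}
    (h : ∫⁻ ω, ENNReal.ofReal (Real.exp (|Y ω| / C)) ∂P ≤ 2) :
    Integrable (fun ω => Real.exp (|Y ω| / C)) P := by
  refine ⟨by fun_prop, ?_⟩
  rw [hasFiniteIntegral_iff_ofReal (ae_of_all _ fun ω => (Real.exp_pos _).le)]
  exact h.trans_lt (by simp)

lemma integrable_of_lintegral_exp_le_two (hY : Measurable Y) {C : ℝ} (hC : 0 < C)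
    (h : ∫⁻ ω, ENNReal.ofReal (Real.exp (|Y ω| / C)) ∂P ≤ 2) : Integrable Y P := by
  refine ((integrable_exp_of_lintegral_le_two hY h).const_mul C).mono' (by fun_prop)
    (ae_of_all _ fun ω => ?_)
  rw [Real.norm_eq_abs, ← div_le_iff₀' hC]
  linarith [Real.add_one_le_exp (|Y ω| / C)]

lemma integral_exp_le_two (hY : Measurable Y) {C : ℝ}
    (h : ∫⁻ ω, ENNReal.ofReal (Real.exp (|Y ω| / C)) ∂P ≤ 2) :
    ∫ ω, Real.exp (|Y ω| / C) ∂P ≤ 2 := by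
  rw [integral_eq_lintegral_of_nonneg_ae (ae_of_all _ fun ω => (Real.exp_pos _).le) (by fun_prop)]
  exact ENNReal.toReal_le_of_le_ofReal (by norm_num) (by simpa using h)

lemma integral_abs_le_of_lintegral_exp_le_two [IsProbabilityMeasure P] (hY : Measurable Y) {C : ℝ}
    (hC : 0 < C) (h : ∫⁻ ω, ENNReal.ofReal (Real.exp (|Y ω| / C)) ∂P ≤ 2) :
    ∫ ω, Y ω ∂P ≤ C := by
  have h1 : ∫ ω, Y ω ∂P ≤ ∫ ω, C * (Real.exp (|Y ω| / C) - 1) ∂P := by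
    refine integral_mono (integrable_of_lintegral_exp_le_two hY hC h)
      (((integrable_exp_of_lintegral_le_two hY h).sub (integrable_const 1)).const_mul C)
      fun ω => (le_abs_self _).trans ?_
    rw [← div_le_iff₀' hC]
    linarith [Real.add_one_le_exp (|Y ω| / C)]
  rw [integral_const_mul, integral_sub (integrable_exp_of_lintegral_le_two hY h)
    (integrable_const 1), integral_const] at h1
  have := integral_exp_le_two hY h
  simp at h1
  nlinarith

end Orlicz

section Arms

variable {n : ℕ} {ν : Fin n → Measure ℝ} {α η : ℝ}

lemma SubExponentialArms.integrable_id (hν : SubExponentialArms ν α) (i : Fin n) :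
    Integrable (fun x => x) (ν i) := by
  have := hν.isProb i
  have hlt : psiOneNorm (ν i) (fun x => x - mean ν i) < ENNReal.ofReal (α + 1) :=
    (hν.psiOne_le i).trans_lt
      ((ENNReal.ofReal_lt_ofReal_iff (by linarith [hν.alpha_nonneg])).2 (by linarith))
  have h1 : Integrable (fun x => x - mean ν i) (ν i) :=
    integrable_of_lintegral_exp_le_two (by fun_prop) (by linarith [hν.alpha_nonneg])
      (lintegral_exp_le_two_of_psiOneNorm_lt hlt)
  exact (h1.add (integrable_const (mean ν i))).congr (ae_of_all _ fun x => by simp)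

lemma SubExponentialArms.mean_pos (hν : SubExponentialArms ν α) (i : Fin n) : 0 < mean ν i := by
  have := hν.isProb i
  refine (integral_pos_iff_support_of_nonneg_ae ?_ (hν.integrable_id i)).2 ?_
  · filter_upwards [hν.pos i] with x hx using hx.le
  · have h1 : ∀ᵐ x ∂(ν i), x ∈ Function.support (fun x : ℝ => x) := by
      filter_upwards [hν.pos i] with x hx using hx.ne'
    rw [(prob_compl_eq_zero_iff (measurableSet_support (f := fun x : ℝ => x) measurable_id)).1
      (ae_iff.1 h1)]
    exact one_pos

/-- A positive variable satisfies `𝔼 X ≤ ‖X‖_{ψ₁}`, hence `η ≥ 1`. -/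
lemma SubExponentialArms.one_le_of_psiOneNorm_div_le (hν : SubExponentialArms ν α) (i : Fin n)
    (hη : psiOneNorm (ν i) (fun x => x) / ENNReal.ofReal (mean ν i) ≤ ENNReal.ofReal η) :
    1 ≤ η := by
  have := hν.isProb i
  have hm := hν.mean_pos i
  have h1 : ENNReal.ofReal (mean ν i) ≤ psiOneNorm (ν i) (fun x => x) :=
    le_iInf fun C => le_iInf fun hC => le_iInf fun h => ENNReal.ofReal_le_ofReal
      (integral_abs_le_of_lintegral_exp_le_two measurable_id hC h)
  have h2 : (1 : ℝ≥0∞) ≤ ENNReal.ofReal η := by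
    refine le_trans ?_ hη
    rw [ENNReal.le_div_iff_mul_le (Or.inl (by simpa using hm)) (Or.inl ENNReal.ofReal_ne_top)]
    simpa using h1
  exact ENNReal.one_le_ofReal.1 h2

lemma SubExponentialArms.lintegral_exp_le_two (hν : SubExponentialArms ν α) (i : Fin n)
    (hη : psiOneNorm (ν i) (fun x => x) / ENNReal.ofReal (mean ν i) ≤ ENNReal.ofReal η) :
    ∫⁻ x, ENNReal.ofReal (Real.exp (|x| / (η * mean ν i))) ∂(ν i) ≤ 2 := by
  have hm := hν.mean_pos i
  have h1 := hν.one_le_of_psiOneNorm_div_le i hη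
  refine lintegral_exp_le_two_of_psiOneNorm_le measurable_id (by positivity) ?_
  rw [ENNReal.div_le_iff (by simpa using hm) ENNReal.ofReal_ne_top] at hη
  rwa [ENNReal.ofReal_mul (by linarith)]

/-- Both the centred normalized variable `W - 𝔼 W`, `W = X / (η 𝔼 X)`, and its negative have a
logarithmic moment generating function at most `(2/5) l²` on `[0, 1/4]`. -/
lemma SubExponentialArms.lintegral_exp_mul_le (hν : SubExponentialArms ν α) (i : Fin n)
    (hη : psiOneNorm (ν i) (fun x => x) / ENNReal.ofReal (mean ν i) ≤ ENNReal.ofReal η)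
    {l e : ℝ} (hl0 : 0 ≤ l) (hl : l ≤ 1 / 4) (he : e = 1 ∨ e = -1) :
    ∫⁻ x, ENNReal.ofReal (Real.exp (l * (e * ((x - mean ν i) / (η * mean ν i))))) ∂(ν i)
      ≤ ENNReal.ofReal (Real.exp (2 / 5 * l ^ 2)) := by
  have := hν.isProb i
  have hm := hν.mean_pos i
  have h1 := hν.one_le_of_psiOneNorm_div_le i hη
  have hE := hν.lintegral_exp_le_two i hη
  set σ := η * mean ν i with hσ
  have hσ0 : 0 < σ := by positivity
  have hint := integrable_exp_of_lintegral_le_two measurable_id hE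
  have hE2 := integral_exp_le_two measurable_id hE
  have hid := hν.integrable_id i
  simp only [id] at hint hE2
  have hlin : Integrable (fun x => 1 + l * e * (x / σ)) (ν i) :=
    (integrable_const 1).add ((hid.div_const σ).const_mul (l * e))
  have hquad : Integrable (fun x => 2 / 5 * l ^ 2 * (Real.exp (|x| / σ) - 1)) (ν i) :=
    (hint.sub (integrable_const 1)).const_mul _
  have hbd : ∀ᵐ x ∂(ν i), Real.exp (l * e * (x / σ))
      ≤ (1 + l * e * (x / σ)) + 2 / 5 * l ^ 2 * (Real.exp (|x| / σ) - 1) := by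
    filter_upwards [hν.pos i] with x hx
    have hxσ : 0 ≤ x / σ := by positivity
    rw [abs_of_pos hx]
    rcases he with rfl | rfl
    · simpa using exp_mul_le hl0 hl hxσ
    · have := exp_neg_mul_le hl0 hxσ
      simpa [sub_eq_add_neg] using this
  have hmgf : Integrable (fun x => Real.exp (l * e * (x / σ))) (ν i) := by
    refine (hlin.add hquad).mono' (by fun_prop) ?_
    filter_upwards [hbd] with x hx
    simpa [abs_of_pos (Real.exp_pos _)] using hx
  have hle : ∫ x, Real.exp (l * e * (x / σ)) ∂(ν i)
      ≤ Real.exp (l * e * (mean ν i / σ) + 2 / 5 * l ^ 2) := by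
    refine (integral_mono_ae hmgf (hlin.add hquad) hbd).trans ?_
    have h3 : ∫ x, ((1 + l * e * (x / σ)) + 2 / 5 * l ^ 2 * (Real.exp (|x| / σ) - 1)) ∂(ν i)
        = 1 + l * e * (mean ν i / σ) + 2 / 5 * l ^ 2 * (∫ x, Real.exp (|x| / σ) ∂(ν i) - 1) := by
      rw [integral_add hlin hquad, integral_add (integrable_const 1)
        ((hid.div_const σ).const_mul (l * e)), integral_const_mul, integral_const_mul,
        integral_sub hint (integrable_const 1), integral_div]
      simp [mean]
    have h4 := Real.add_one_le_exp (l * e * (mean ν i / σ) + 2 / 5 * l ^ 2)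
    have h5 := mul_le_mul_of_nonneg_left hE2 (show 0 ≤ 2 / 5 * l ^ 2 by positivity)
    simp only [Pi.add_apply]
    rw [h3]
    linarith
  have hfac (x : ℝ) : Real.exp (l * (e * ((x - mean ν i) / σ)))
      = Real.exp (-(l * e * (mean ν i / σ))) * Real.exp (l * e * (x / σ)) := by
    rw [← Real.exp_add]; congr 1; ring
  rw [← ofReal_integral_eq_lintegral_ofReal]
  · apply ENNReal.ofReal_le_ofReal
    simp_rw [hfac]
    rw [integral_const_mul]
    calc _ ≤ Real.exp (-(l * e * (mean ν i / σ)))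
          * Real.exp (l * e * (mean ν i / σ) + 2 / 5 * l ^ 2) := by gcongr
      _ = _ := by rw [← Real.exp_add]; congr 1; ring
  · simp_rw [hfac]
    exact hmgf.const_mul _
  · exact ae_of_all _ fun x => (Real.exp_pos _).le

end Arms


/-! ### A deviation inequality for adaptively chosen sample sizes -/

/-- The exponential tilt used once `K` samples have been allocated: `g / √K`, capped at `1/4`. -/
noncomputable def tilt (g K : ℝ) : ℝ := g / max (4 * g) (√K)

/-- The potential `exp (l S - (4/5) l² K)` with `l = tilt g K`, for `K` samples with sum `S`. -/
noncomputable def potential (g K S : ℝ) : ℝ :=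
  Real.exp (tilt g K * S - 4 / 5 * tilt g K ^ 2 * K)

lemma potential_pos (g K S : ℝ) : 0 < potential g K S := Real.exp_pos _

lemma tilt_pos {g : ℝ} (hg : 0 < g) (K : ℝ) : 0 < tilt g K := by
  unfold tilt; positivity

lemma tilt_le {g : ℝ} (hg : 0 < g) (K : ℝ) : tilt g K ≤ 1 / 4 := by
  unfold tilt
  rw [div_le_iff₀ (by positivity)]
  linarith [le_max_left (4 * g) (√K)]

lemma tilt_antitone {g : ℝ} (hg : 0 < g) : Antitone (tilt g) := fun K K' h => by
  unfold tilt
  gcongr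

/-- The tilt decreases more slowly than `K ^ (-1/2)`, by the inequality of arithmetic and
geometric means. -/
lemma tilt_mul_le {g K a : ℝ} (hg : 0 < g) (hK : 0 ≤ K) (ha : 0 ≤ a) :
    tilt g K * K ≤ tilt g (K + a) * (K + a / 2) := by
  unfold tilt
  rw [div_mul_eq_mul_div, div_mul_eq_mul_div, div_le_div_iff₀ (by positivity) (by positivity)]
  have hmain : K * max (4 * g) (√(K + a)) ≤ (K + a / 2) * max (4 * g) (√K) := by
    rcases max_cases (4 * g) (√(K + a)) with ⟨h, -⟩ | ⟨h, -⟩ <;> rw [h]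
    · gcongr
      · linarith
      · exact le_max_left _ _
    · have hs : √K ≤ √(K + a) := Real.sqrt_le_sqrt (by linarith)
      have e1 := Real.sq_sqrt hK
      have e2 := Real.sq_sqrt (show 0 ≤ K + a by linarith)
      have h3 : K * √(K + a) ≤ (K + a / 2) * √K := by
        have e3 : K + a / 2 = (√K ^ 2 + √(K + a) ^ 2) / 2 := by rw [e1, e2]; ring
        have e4 : K * √(K + a) = √K ^ 2 * √(K + a) := by rw [e1]
        rw [e3, e4]
        nlinarith [mul_nonneg (Real.sqrt_nonneg K) (sq_nonneg (√(K + a) - √K))]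
      exact h3.trans (mul_le_mul_of_nonneg_left (le_max_right _ _) (by linarith))
  nlinarith

/-- One step of the potential. If the exponent on the left is positive then `s` is so large that
keeping the larger old tilt, with the old compensator, is at least as good. -/
lemma tilt_step {g K a s : ℝ} (hg : 0 < g) (hK : 0 ≤ K) (ha : 0 ≤ a) :
    tilt g (K + a) * s - 4 / 5 * tilt g (K + a) ^ 2 * (K + a) + 2 / 5 * tilt g (K + a) ^ 2 * a
      ≤ max (tilt g K * s - 4 / 5 * tilt g K ^ 2 * K) 0 := by
  have h1 : tilt g (K + a) ≤ tilt g K := tilt_antitone hg (by linarith)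
  have h2 := tilt_mul_le hg hK ha
  have h3 := tilt_pos hg (K + a)
  have h4 := tilt_pos hg K
  set l := tilt g K
  set l' := tilt g (K + a)
  by_contra! hlt
  obtain ⟨hE, h0⟩ := max_lt_iff.1 hlt
  have hs : 4 / 5 * l' * (K + a / 2) < s := by
    have : 0 < l' * (s - 4 / 5 * l' * (K + a / 2)) := by nlinarith
    linarith [pos_of_mul_pos_right this h3.le]
  nlinarith [mul_nonneg (sub_nonneg.2 h1) (sub_nonneg.2 hs.le),
    mul_nonneg h4.le (sub_nonneg.2 h2)]

lemma potential_step {g K a s : ℝ} (hg : 0 < g) (hK : 0 ≤ K) (ha : 0 ≤ a) :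
    potential g (K + a) s * Real.exp (2 / 5 * tilt g (K + a) ^ 2 * a)
      ≤ max (potential g K s) 1 := by
  unfold potential
  rw [← Real.exp_add, ← Real.exp_zero, ← Real.exp_monotone.map_max]
  exact Real.exp_le_exp.2 (tilt_step hg hK ha)

/-- A deviation of more than `2√(L/K) + 2L/K` makes the potential with `g = (5/4)√L` at least
`exp (5L/4)`. -/
lemma exp_le_potential {L K S : ℝ} (hL : 0 < L) (hK : 0 < K)
    (hC : 2 * √(L / K) + 2 * (L / K) < 1)
    (hS : K * (2 * √(L / K) + 2 * (L / K)) ≤ S) :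
    Real.exp (5 / 4 * L) ≤ potential (5 / 4 * √L) K S := by
  unfold potential
  apply Real.exp_le_exp.2
  have hg : 0 < 5 / 4 * √L := by positivity
  have hl0 := tilt_pos hg K
  have hx0 : 0 < √(L / K) := by positivity
  have hx2 : √(L / K) ^ 2 = L / K := Real.sq_sqrt (by positivity)
  have hLK : L = K * √(L / K) ^ 2 := by rw [hx2]; field_simp
  have hsq : √L = √K * √(L / K) := by
    rw [← Real.sqrt_mul hK.le]; congr 1; field_simp
  have hKs : √K ^ 2 = K := Real.sq_sqrt hK.le
  have hKp : 0 < √K := Real.sqrt_pos.2 hK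
  set x := √(L / K)
  rw [← hx2] at hC hS
  have hlS := mul_le_mul_of_nonneg_left hS hl0.le
  refine le_trans ?_ (sub_le_sub_right hlS _)
  -- the tilt is either capped at `1/4` or equal to `(5/4) √(L / K)`
  rcases le_total (√K) (4 * (5 / 4 * √L)) with h | h
  · have hl : tilt (5 / 4 * √L) K = 1 / 4 := by
      unfold tilt; rw [max_eq_left h]; field_simp
    have hx : 1 / 5 ≤ x := by
      rw [hsq] at h; nlinarith
    rw [hl]
    have : 0 ≤ 1 / 2 * x - 3 / 4 * x ^ 2 - 1 / 20 := by nlinarith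
    nlinarith [mul_nonneg hK.le this]
  · have hl : tilt (5 / 4 * √L) K = 5 / 4 * x := by
      unfold tilt; rw [max_eq_right h, hsq]; field_simp
    rw [hl]
    have : 0 ≤ K * x ^ 3 := by positivity
    nlinarith

variable {B : ℕ} {Ω : Type*} {mΩ : MeasurableSpace Ω} {P : Measure Ω} {ℱ : Filtration ℕ mΩ}
  {Z : ℕ → Fin B → Ω → ℝ} {a : ℕ → Ω → ℕ}

/-- A stream of noise variables observed in rounds: in round `t` the variables `Z t u`, `u < a t`,
are observed, where `a t` is determined before the round. The noise variables of a round are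
independent of each other and of the past, and their logarithmic moment generating function is at
most `(2/5) l²` for `l ∈ [0, 1/4]`. -/
structure IsAdaptiveNoise (P : Measure Ω) (ℱ : Filtration ℕ mΩ) (Z : ℕ → Fin B → Ω → ℝ)
    (a : ℕ → Ω → ℕ) : Prop where
  measurable_size : ∀ t, Measurable[ℱ t] (a t)
  measurable_noise : ∀ t u, Measurable[ℱ (t + 1)] (Z t u)
  indep_past : ∀ t, Indep (ℱ t)
    (MeasurableSpace.comap (fun ω u => Z t u ω) inferInstance) P
  iIndepFun_round : ∀ t, iIndepFun (Z t) P
  lintegral_exp_le : ∀ t u (l : ℝ), 0 ≤ l → l ≤ 1 / 4 →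
    ∫⁻ ω, ENNReal.ofReal (Real.exp (l * Z t u ω)) ∂P
      ≤ ENNReal.ofReal (Real.exp (2 / 5 * l ^ 2))

/-- Number of observations before round `t`. -/
def observedCount (a : ℕ → Ω → ℕ) (t : ℕ) (ω : Ω) : ℕ := ∑ q ∈ Finset.range t, a q ω

/-- Sum of the observations before round `t`. -/
noncomputable def observedSum (Z : ℕ → Fin B → Ω → ℝ) (a : ℕ → Ω → ℕ) (t : ℕ) (ω : Ω) : ℝ :=
  ∑ q ∈ Finset.range t, ∑ u ∈ Finset.univ.filter (fun u : Fin B => (u : ℕ) < a q ω), Z q u ω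

/-- The event that the mean of the observations before round `t` exceeds the confidence width at
level `L`, while this width is less than `1`. -/
def deviationEvent (Z : ℕ → Fin B → Ω → ℝ) (a : ℕ → Ω → ℕ) (L : ℝ) (t : ℕ) : Set Ω :=
  {ω | 0 < observedCount a t ω ∧
    2 * √(L / (observedCount a t ω : ℝ)) + 2 * (L / (observedCount a t ω : ℝ)) < 1 ∧
    (observedCount a t ω : ℝ) * (2 * √(L / (observedCount a t ω : ℝ))
      + 2 * (L / (observedCount a t ω : ℝ))) ≤ observedSum Z a t ω}

@[simp] lemma deviationEvent_zero (Z : ℕ → Fin B → Ω → ℝ) (a : ℕ → Ω → ℕ) (L : ℝ) :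
    deviationEvent Z a L 0 = ∅ := by
  simp [deviationEvent, observedCount]

namespace IsAdaptiveNoise

lemma measurable_count (h : IsAdaptiveNoise P ℱ Z a) {t m : ℕ} (htm : t ≤ m + 1) :
    Measurable[ℱ m] (observedCount a t) := by
  unfold observedCount
  refine Finset.measurable_fun_sum _ fun q hq => ?_
  exact (h.measurable_size q).mono (ℱ.mono (by have := Finset.mem_range.1 hq; omega)) le_rfl

lemma measurable_sum (h : IsAdaptiveNoise P ℱ Z a) (t : ℕ) :
    Measurable[ℱ t] (observedSum Z a t) := by
  unfold observedSum
  refine Finset.measurable_fun_sum _ fun q hq => ?_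
  have hq' : q + 1 ≤ t := Finset.mem_range.1 hq
  simp_rw [Finset.sum_filter]
  refine Finset.measurable_fun_sum _ fun u _ => ?_
  refine Measurable.ite ?_ ((h.measurable_noise q u).mono (ℱ.mono hq') le_rfl) measurable_const
  exact ((h.measurable_size q).mono (ℱ.mono (by omega)) le_rfl)
    (MeasurableSet.of_discrete (s := {m : ℕ | (u : ℕ) < m}))

lemma measurableSet_deviationEvent (h : IsAdaptiveNoise P ℱ Z a) (L : ℝ) (t : ℕ) :
    MeasurableSet (deviationEvent Z a L t) := by
  have hN : Measurable (observedCount a t) :=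
    (h.measurable_count (m := t) (by omega)).mono (ℱ.le _) le_rfl
  have hcast : Measurable (fun m : ℕ => (m : ℝ)) := .of_discrete
  have hK : Measurable fun ω => (observedCount a t ω : ℝ) := hcast.comp hN
  have hS : Measurable (observedSum Z a t) := (h.measurable_sum _).mono (ℱ.le _) le_rfl
  have hW : Measurable fun ω => 2 * √(L / (observedCount a t ω : ℝ))
      + 2 * (L / (observedCount a t ω : ℝ)) := by fun_prop
  exact (measurableSet_lt measurable_const hN).inter
    ((measurableSet_lt hW measurable_const).inter (measurableSet_le (hK.mul hW) hS))

/-- Moment generating function of the sum of the observations of a round of fixed size. -/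
lemma lintegral_exp_sum_le (h : IsAdaptiveNoise P ℱ Z a) (t m : ℕ) {l : ℝ} (hl0 : 0 ≤ l)
    (hl : l ≤ 1 / 4) :
    ∫⁻ ω, ENNReal.ofReal (Real.exp
        (l * ∑ u ∈ Finset.univ.filter (fun u : Fin B => (u : ℕ) < m), Z t u ω)) ∂P
      ≤ ENNReal.ofReal (Real.exp (2 / 5 * l ^ 2 * m)) := by
  set s := Finset.univ.filter (fun u : Fin B => (u : ℕ) < m)
  have hprod (ω : Ω) : ENNReal.ofReal (Real.exp (l * ∑ u ∈ s, Z t u ω))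
      = ∏ u ∈ s, ENNReal.ofReal (Real.exp (l * Z t u ω)) := by
    rw [Finset.mul_sum, Real.exp_sum, ENNReal.ofReal_prod_of_nonneg fun _ _ => (Real.exp_pos _).le]
  have hf : Measurable (fun x : ℝ => ENNReal.ofReal (Real.exp (l * x))) := by fun_prop
  simp_rw [hprod]
  rw [lintegral_prod_eq_prod_lintegral_of_indepFun s
    (fun u ω => ENNReal.ofReal (Real.exp (l * Z t u ω)))
    ((h.iIndepFun_round t).comp (fun _ x => ENNReal.ofReal (Real.exp (l * x))) fun _ => hf)
    fun u => hf.comp ((h.measurable_noise t u).mono (ℱ.le _) le_rfl)]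
  have hcard : s.card ≤ m := by
    have : s.card ≤ (Finset.range m).card :=
      Finset.card_le_card_of_injOn (fun u : Fin B => (u : ℕ)) (fun u hu => by simpa [s] using hu)
        fun u _ v _ huv => Fin.ext huv
    simpa using this
  calc ∏ u ∈ s, ∫⁻ ω, ENNReal.ofReal (Real.exp (l * Z t u ω)) ∂P
      ≤ ∏ _u ∈ s, ENNReal.ofReal (Real.exp (2 / 5 * l ^ 2)) :=
        Finset.prod_le_prod' fun u _ => h.lintegral_exp_le t u l hl0 hl
    _ = ENNReal.ofReal (Real.exp (2 / 5 * l ^ 2 * s.card)) := by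
        rw [Finset.prod_const, ← ENNReal.ofReal_pow (Real.exp_pos _).le, ← Real.exp_nat_mul]
        congr 2; ring
    _ ≤ _ := by gcongr

/-- The potential is a supermartingale as long as it is at least `1`. -/
lemma lintegral_potential_succ_le [IsProbabilityMeasure P] (h : IsAdaptiveNoise P ℱ Z a) {g : ℝ}
    (hg : 0 < g) (t : ℕ) :
    ∫⁻ ω, ENNReal.ofReal (potential g (observedCount a (t + 1) ω) (observedSum Z a (t + 1) ω)) ∂P
      ≤ ∫⁻ ω, max (ENNReal.ofReal (potential g (observedCount a t ω) (observedSum Z a t ω))) 1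
          ∂P := by
  set V : Ω → ℕ × ℕ × ℝ := fun ω => (observedCount a t ω, a t ω, observedSum Z a t ω) with hVdef
  set Y : Ω → Fin B → ℝ := fun ω u => Z t u ω with hYdef
  have hV : Measurable[ℱ t] V :=
    (h.measurable_count (by omega)).prodMk ((h.measurable_size t).prodMk (h.measurable_sum t))
  have hV' : Measurable V := hV.mono (ℱ.le _) le_rfl
  have hY : Measurable Y :=
    measurable_pi_lambda _ fun u => (h.measurable_noise t u).mono (ℱ.le _) le_rfl
  have hind : IndepFun V Y P := by
    rw [IndepFun_iff_Indep]
    exact indep_of_indep_of_le_left (h.indep_past t) hV.comap_le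
  -- the potential after the round, as a function of the past and of the noise of the round
  set F : (ℕ × ℕ × ℝ) × (Fin B → ℝ) → ℝ≥0∞ := fun p =>
    ENNReal.ofReal (potential g ((p.1.1 : ℝ) + (p.1.2.1 : ℝ)) (p.1.2.2 +
      ∑ u ∈ Finset.univ.filter (fun u : Fin B => (u : ℕ) < p.1.2.1), p.2 u)) with hFdef
  have hF : Measurable F := by
    simp_rw [hFdef, Finset.sum_filter]
    have hite (u : Fin B) : Measurable fun p : (ℕ × ℕ × ℝ) × (Fin B → ℝ) =>
        if (u : ℕ) < p.1.2.1 then p.2 u else 0 := by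
      refine Measurable.ite ?_ (by fun_prop) measurable_const
      exact (show Measurable fun p : (ℕ × ℕ × ℝ) × (Fin B → ℝ) => p.1.2.1 by fun_prop)
        (MeasurableSet.of_discrete (s := {m : ℕ | (u : ℕ) < m}))
    have hcast : Measurable (fun m : ℕ => (m : ℝ)) := .of_discrete
    have hK : Measurable fun p : (ℕ × ℕ × ℝ) × (Fin B → ℝ) => (p.1.1 : ℝ) + (p.1.2.1 : ℝ) :=
      (hcast.comp (by fun_prop)).add (hcast.comp (by fun_prop))
    have hsum : Measurable fun p : (ℕ × ℕ × ℝ) × (Fin B → ℝ) =>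
        p.1.2.2 + ∑ u : Fin B, if (u : ℕ) < p.1.2.1 then p.2 u else 0 :=
      (by fun_prop : Measurable fun p : (ℕ × ℕ × ℝ) × (Fin B → ℝ) => p.1.2.2).add
        (Finset.measurable_fun_sum _ fun u _ => hite u)
    unfold potential tilt
    fun_prop
  have hnext (ω : Ω) : ENNReal.ofReal
      (potential g (observedCount a (t + 1) ω) (observedSum Z a (t + 1) ω)) = F (V ω, Y ω) := by
    simp [hFdef, hVdef, hYdef, observedCount, observedSum, Finset.sum_range_succ]
  calc _ = ∫⁻ ω, F (V ω, Y ω) ∂P := lintegral_congr hnext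
    _ = ∫⁻ p, F p ∂(P.map fun ω => (V ω, Y ω)) := (lintegral_map hF (hV'.prodMk hY)).symm
    _ = ∫⁻ v, ∫⁻ y, F (v, y) ∂(P.map Y) ∂(P.map V) := by
        have := Measure.isProbabilityMeasure_map (μ := P) hY.aemeasurable
        rw [(indepFun_iff_map_prod_eq_prod_map_map hV'.aemeasurable hY.aemeasurable).1 hind,
          lintegral_prod _ hF.aemeasurable]
    _ ≤ ∫⁻ v, max (ENNReal.ofReal (potential g v.1 v.2.2)) 1 ∂(P.map V) := by
        refine lintegral_mono fun v => ?_
        rw [lintegral_map (f := fun y => F (v, y)) (hF.comp (by fun_prop)) hY]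
        obtain ⟨K, m, s⟩ := v
        have hfac (ω : Ω) : F ((K, m, s), Y ω) = ENNReal.ofReal (potential g (K + m) s)
            * ENNReal.ofReal (Real.exp (tilt g (K + m) *
              ∑ u ∈ Finset.univ.filter (fun u : Fin B => (u : ℕ) < m), Z t u ω)) := by
          rw [← ENNReal.ofReal_mul (potential_pos _ _ _).le]
          simp only [hFdef, hYdef, potential]
          rw [← Real.exp_add]
          congr 2; ring
        simp_rw [hfac]
        rw [lintegral_const_mul' _ _ ENNReal.ofReal_ne_top]
        calc _ ≤ ENNReal.ofReal (potential g (K + m) s)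
              * ENNReal.ofReal (Real.exp (2 / 5 * tilt g (K + m) ^ 2 * m)) := by
              gcongr
              exact h.lintegral_exp_sum_le t m (tilt_pos hg _).le (tilt_le hg _)
          _ ≤ max (ENNReal.ofReal (potential g K s)) 1 := by
              rw [← ENNReal.ofReal_mul (potential_pos _ _ _).le, ← ENNReal.ofReal_one,
                ← ENNReal.ofReal_mono.map_max]
              exact ENNReal.ofReal_le_ofReal
                (potential_step hg (Nat.cast_nonneg _) (Nat.cast_nonneg _))
    _ = _ := by
        rw [lintegral_map ?_ hV']
        have hcast : Measurable (fun m : ℕ => (m : ℝ)) := .of_discrete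
        have hK : Measurable fun v : ℕ × ℕ × ℝ => (v.1 : ℝ) := hcast.comp measurable_fst
        unfold potential tilt
        fun_prop

lemma lintegral_potential_le [IsProbabilityMeasure P] (h : IsAdaptiveNoise P ℱ Z a) {g : ℝ}
    (hg : 0 < g) (t : ℕ) :
    ∫⁻ ω, ENNReal.ofReal (potential g (observedCount a (t + 1) ω) (observedSum Z a (t + 1) ω)) ∂P
      ≤ (t + 1 : ℕ) := by
  induction t with
  | zero =>
    refine (h.lintegral_potential_succ_le hg 0).trans ?_
    simp [observedCount, observedSum, potential]
  | succ t ih =>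
    refine (h.lintegral_potential_succ_le hg (t + 1)).trans ?_
    calc _ ≤ ∫⁻ ω, (ENNReal.ofReal (potential g (observedCount a (t + 1) ω)
              (observedSum Z a (t + 1) ω)) + 1) ∂P :=
          lintegral_mono fun ω => max_le le_self_add le_add_self
      _ ≤ (t + 1 : ℕ) + 1 := by
          rw [lintegral_add_right _ measurable_const]
          simpa using ih
      _ = _ := by push_cast; ring

/-- Deviation of the mean of adaptively many observations before round `t`. The factor `t` takes
the place of a union bound over the possible sample sizes. -/
lemma measure_deviationEvent_le [IsProbabilityMeasure P] (h : IsAdaptiveNoise P ℱ Z a) {t : ℕ}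
    (ht : 1 ≤ t) {L : ℝ} (hL : 0 < L) :
    P (deviationEvent Z a L t) ≤ ENNReal.ofReal (t * Real.exp (-(5 / 4 * L))) := by
  obtain ⟨t, rfl⟩ : ∃ s, t = s + 1 := ⟨t - 1, by omega⟩
  set ε : ℝ≥0∞ := ENNReal.ofReal (Real.exp (5 / 4 * L)) with hε
  have hε0 : ε ≠ 0 := by simp [hε, Real.exp_pos]
  have hmarkov : ε * P {ω | ε ≤ ENNReal.ofReal (potential (5 / 4 * √L)
      (observedCount a (t + 1) ω) (observedSum Z a (t + 1) ω))} ≤ (t + 1 : ℕ) :=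
    (mul_meas_ge_le_lintegral₀ (by
      have hcast : Measurable (fun m : ℕ => (m : ℝ)) := .of_discrete
      have hK : Measurable fun ω => (observedCount a (t + 1) ω : ℝ) :=
        hcast.comp ((h.measurable_count (m := t) le_rfl).mono (ℱ.le _) le_rfl)
      have hS : Measurable (observedSum Z a (t + 1)) :=
        (h.measurable_sum _).mono (ℱ.le _) le_rfl
      unfold potential tilt
      fun_prop) _).trans (h.lintegral_potential_le (by positivity) t)
  calc _ ≤ P {ω | ε ≤ ENNReal.ofReal (potential (5 / 4 * √L)
          (observedCount a (t + 1) ω) (observedSum Z a (t + 1) ω))} := by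
        refine measure_mono fun ω hω => ?_
        exact ENNReal.ofReal_le_ofReal
          (exp_le_potential hL (Nat.cast_pos.2 hω.1) hω.2.1 hω.2.2)
    _ ≤ (t + 1 : ℕ) / ε := by
        rw [ENNReal.le_div_iff_mul_le (Or.inl hε0) (Or.inl ENNReal.ofReal_ne_top), mul_comm]
        exact hmarkov
    _ = _ := by
        rw [hε, Real.exp_neg, ← div_eq_mul_inv, ENNReal.ofReal_div_of_pos (Real.exp_pos _),
          ENNReal.ofReal_natCast]

end IsAdaptiveNoise

/-- The failure probability in round `k = t + 1` is at most a telescoping term. -/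
lemma mul_exp_log_le {t : ℕ} (ht : 1 ≤ t) :
    (t : ℝ) * Real.exp (-(5 / 4 * Real.log (2 * ((t : ℝ) + 1) ^ 2)))
      ≤ 1 / √t - 1 / √((t : ℝ) + 1) := by
  have ht' : (0 : ℝ) < t := by exact_mod_cast ht
  set k : ℝ := (t : ℝ) + 1 with hk
  have hk0 : 0 < k := by positivity
  have hp : 0 < √(t : ℝ) := Real.sqrt_pos.2 ht'
  have hq : 0 < √k := Real.sqrt_pos.2 hk0
  have hp2 := Real.sq_sqrt ht'.le
  have hq2 := Real.sq_sqrt hk0.le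
  have hpq : √(t : ℝ) ≤ √k := Real.sqrt_le_sqrt (by linarith)
  have hexp : 2 * k ^ 2 * √k ≤ Real.exp (5 / 4 * Real.log (2 * k ^ 2)) := by
    have e1 : Real.exp (5 / 4 * Real.log (2 * k ^ 2))
        = 2 * k ^ 2 * Real.exp (1 / 4 * Real.log (2 * k ^ 2)) := by
      rw [← Real.exp_log (show 0 < 2 * k ^ 2 by positivity), ← Real.exp_add, Real.log_exp]
      congr 1; ring
    have e2 : √k ≤ Real.exp (1 / 4 * Real.log (2 * k ^ 2)) := by
      rw [← Real.exp_log hq, Real.log_sqrt hk0.le, Real.log_mul (by norm_num) (by positivity),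
        Real.log_pow]
      apply Real.exp_le_exp.2
      have := Real.log_pos (show (1 : ℝ) < 2 by norm_num)
      push_cast
      linarith
    rw [e1]
    gcongr
  calc (t : ℝ) * Real.exp (-(5 / 4 * Real.log (2 * k ^ 2)))
      ≤ k * (2 * k ^ 2 * √k)⁻¹ := by
        rw [Real.exp_neg]
        gcongr
        linarith
    _ = 1 / (2 * k * √k) := by field_simp
    _ ≤ 1 / (√t * √k * (√t + √k)) := by
        apply one_div_le_one_div_of_le (by positivity)
        calc √t * √k * (√t + √k) ≤ √k * √k * (√k + √k) := by gcongr
          _ = 2 * (√k ^ 2) * √k := by ring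
          _ = _ := by rw [hq2]
    _ = 1 / √t - 1 / √k := by
        have hdiff : (√k - √t) * (√t + √k) = 1 := by
          ring_nf; rw [hq2, hp2, hk]; ring
        field_simp
        linarith

/-- At the levels `log (2k²)`, `k = t + 1`, the deviation events have total probability at
most `1`. -/
lemma IsAdaptiveNoise.sum_measureReal_deviationEvent_le [IsProbabilityMeasure P]
    (h : IsAdaptiveNoise P ℱ Z a) (K : ℕ) :
    ∑ t ∈ Finset.range K, P.real (deviationEvent Z a (Real.log (2 * ((t : ℝ) + 1) ^ 2)) t)
      ≤ 1 := by
  have hstep (t : ℕ) (ht : 1 ≤ t) :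
      P.real (deviationEvent Z a (Real.log (2 * ((t : ℝ) + 1) ^ 2)) t)
        ≤ 1 / √t - 1 / √((t : ℝ) + 1) := by
    have hL : 0 < Real.log (2 * ((t : ℝ) + 1) ^ 2) := by
      apply Real.log_pos
      have : (0 : ℝ) ≤ t := t.cast_nonneg
      nlinarith
    exact (ENNReal.toReal_le_of_le_ofReal (by positivity)
      (h.measure_deviationEvent_le ht hL)).trans (mul_exp_log_le ht)
  have hmain (K : ℕ) : ∑ t ∈ Finset.range (K + 1),
      P.real (deviationEvent Z a (Real.log (2 * ((t : ℝ) + 1) ^ 2)) t)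
        ≤ 1 - 1 / √((K : ℝ) + 1) := by
    induction K with
    | zero => simp
    | succ K ih =>
      rw [Finset.sum_range_succ]
      have := hstep (K + 1) (by omega)
      push_cast at this ⊢
      linarith
  rcases K with - | K
  · simp
  · refine (hmain K).trans ?_
    have : 0 ≤ 1 / √((K : ℝ) + 1) := by positivity
    linarith


/-! ### The proxy loss -/

section ProxyLoss

variable {n B : ℕ} {a b : Fin n → ℕ} {s μ : Fin n → ℝ}

lemma le_proxyLoss (a : Fin n → ℕ) (s : Fin n → ℝ) (i : Fin n) : a i * s i ≤ proxyLoss a s :=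
  le_ciSup (f := fun i => (a i : ℝ) * s i) (Set.finite_range _).bddAbove i

lemma exists_eq_proxyLoss (hn : 0 < n) (a : Fin n → ℕ) (s : Fin n → ℝ) :
    ∃ i, a i * s i = proxyLoss a s := by
  have : Nonempty (Fin n) := ⟨⟨0, hn⟩⟩
  exact exists_eq_ciSup_of_finite (f := fun i => (a i : ℝ) * s i)

lemma proxyLoss_nonneg (hs : ∀ i, 0 ≤ s i) : 0 ≤ proxyLoss a s :=
  Real.iSup_nonneg fun i => mul_nonneg (Nat.cast_nonneg _) (hs i)

lemma proxyLoss_mono (h : ∀ i, s i ≤ μ i) : proxyLoss a s ≤ proxyLoss a μ :=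
  ciSup_mono (Set.finite_range _).bddAbove fun i =>
    mul_le_mul_of_nonneg_left (h i) (Nat.cast_nonneg _)

lemma le_of_mem_allocations (ha : a ∈ allocations n B) (i : Fin n) : a i ≤ B := by
  rw [← show ∑ i, a i = B from ha]
  exact Finset.single_le_sum (fun _ _ => Nat.zero_le _) (Finset.mem_univ i)

lemma IsOptimal.proxyLoss_le (ha : IsOptimal B s a) (hs : ∀ i, 0 ≤ s i) (i : Fin n) :
    proxyLoss a s ≤ B * s i := by
  have hmem : Pi.single i B ∈ allocations n B := by simp [allocations]
  have : Nonempty (Fin n) := ⟨i⟩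
  refine (ha.2 _ hmem).trans (ciSup_le fun j => ?_)
  by_cases hj : j = i
  · subst hj; simp
  · simpa [Pi.single_eq_of_ne hj] using mul_nonneg (Nat.cast_nonneg B) (hs i)

end ProxyLoss

/-! ### Counting suboptimal rounds -/

/-- If each marked round adds at least `N` to a running count, and is only marked while the count
is at most `M`, then there are at most `M / N + 1` marked rounds. -/
lemma mul_card_filter_le {N M : ℝ} (hM : 0 ≤ M) (hN : 0 ≤ N) (f : ℕ → ℕ) (K : ℕ) :
    N * (((Finset.range K).filter fun t => N ≤ f t ∧
      ((∑ q ∈ Finset.range t, f q : ℕ) : ℝ) ≤ M).card : ℝ) ≤ M + N := by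
  -- the second bound of the strengthened claim drives the induction
  suffices h : N * (((Finset.range K).filter fun t => N ≤ f t ∧
      ((∑ q ∈ Finset.range t, f q : ℕ) : ℝ) ≤ M).card : ℝ) ≤ M + N ∧
      N * (((Finset.range K).filter fun t => N ≤ f t ∧
      ((∑ q ∈ Finset.range t, f q : ℕ) : ℝ) ≤ M).card : ℝ) ≤
        ((∑ q ∈ Finset.range K, f q : ℕ) : ℝ) from h.1
  induction K with
  | zero => simpa using add_nonneg hM hN
  | succ K ih =>
    rw [Finset.range_add_one, Finset.filter_insert, Finset.sum_insert (by simp)]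
    push_cast at ih ⊢
    split_ifs with hK
    · rw [Finset.card_insert_of_notMem (by simp)]
      push_cast
      constructor <;> nlinarith [hK.1, hK.2, ih.2]
    · exact ⟨ih.1, ih.2.trans (by linarith [(Nat.cast_nonneg (f K) : (0 : ℝ) ≤ f K)])⟩

/-- If the lower confidence bound `s` of an arm with `m` samples satisfies `N s ≤ ℓ < N μ`, then
`m` is at most of order `L / (N μ - ℓ)²`. -/
lemma sample_le_of_lcb_le {m η μ N ℓ L s : ℝ} (hm : 0 < m) (hη : 1 ≤ η) (hμ : 0 < μ)
    (hN : 0 < N) (hℓ : 0 ≤ ℓ) (hL : 0 ≤ L) (hΔ : 0 < N * μ - ℓ)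
    (hs : μ * (1 - 2 * (η * (2 * √(L / m) + 2 * (L / m)))) ≤ s) (hNs : N * s ≤ ℓ) :
    m ≤ 64 * η ^ 2 * μ ^ 2 * N ^ 2 * L / (N * μ - ℓ) ^ 2 := by
  set Δ := N * μ - ℓ with hΔdef
  have hηN : 0 < 2 * η * N * μ := by positivity
  set δ := Δ / (2 * η * N * μ) with hδ
  have hδ0 : 0 < δ := by positivity
  have hδ1 : δ ≤ 1 / 2 := by
    rw [hδ, div_le_iff₀ hηN]
    have := mul_le_mul_of_nonneg_right hη (mul_pos hN hμ).le
    linarith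
  have hy2 := Real.sq_sqrt (show 0 ≤ L / m by positivity)
  have hy0 := Real.sqrt_nonneg (L / m)
  rw [← hy2] at hs
  rw [Real.sqrt_sq hy0] at hs
  set x := √(L / m)
  have hC : δ ≤ 2 * x + 2 * x ^ 2 := by
    rw [hδ, div_le_iff₀ hηN]
    have := mul_le_mul_of_nonneg_left hs hN.le
    linarith
  have hx : δ / 4 ≤ x := by
    by_contra! h
    nlinarith
  have hsq : δ ^ 2 / 16 ≤ L / m := by
    rw [← hy2]; nlinarith
  rw [le_div_iff₀ hm] at hsq
  rw [le_div_iff₀ (by positivity)]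
  have hΔδ : Δ = δ * (2 * η * N * μ) := by rw [hδ]; field_simp
  rw [hΔδ]
  have := mul_le_mul_of_nonneg_left hsq (show 0 ≤ 64 * η ^ 2 * N ^ 2 * μ ^ 2 by positivity)
  linarith

lemma log_two_mul_sq_le {K : ℕ} (hK : 2 ≤ K) :
    Real.log (2 * (K : ℝ) ^ 2) ≤ 3 * Real.log K := by
  have hK' : (2 : ℝ) ≤ K := by exact_mod_cast hK
  rw [Real.log_mul (by norm_num) (by positivity), Real.log_pow]
  have := Real.log_le_log (by norm_num) hK'
  push_cast
  linarith

/-! ### The noise of an arm -/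

section Arms

variable {n B : ℕ} {Ω : Type*} {mΩ : MeasurableSpace Ω} {P : Measure Ω} {ν : Fin n → Measure ℝ}
  {α η : ℝ} {ℱ : Filtration ℕ mΩ} {X : Fin n → ℕ → Fin B → Ω → ℝ} {a : ℕ → Ω → Fin n → ℕ}

/-- The centred computation times of arm `i`, in units of `η μ_i` and with sign `e`. -/
noncomputable def armNoise (ν : Fin n → Measure ℝ) (η e : ℝ) (X : Fin n → ℕ → Fin B → Ω → ℝ)
    (i : Fin n) (t : ℕ) (u : Fin B) (ω : Ω) : ℝ :=
  e * ((X i t u ω - mean ν i) / (η * mean ν i))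

lemma isAdaptiveNoise_armNoise (hν : SubExponentialArms ν α) (hX : IsSampling P ν ℱ X)
    (ha : IsATAEmpirical η ℱ X a) (i : Fin n)
    (hη : psiOneNorm (ν i) (fun x => x) / ENNReal.ofReal (mean ν i) ≤ ENNReal.ofReal η)
    {e : ℝ} (he : e = 1 ∨ e = -1) :
    IsAdaptiveNoise P ℱ (armNoise ν η e X i) (fun t ω => a t ω i) where
  measurable_size t := (measurable_pi_apply i).comp (ha.predictable t)
  measurable_noise t u :=
    (by fun_prop : Measurable fun x : ℝ => e * ((x - mean ν i) / (η * mean ν i))).comp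
      (hX.measurable i t u)
  indep_past t := by
    refine indep_of_indep_of_le_right (hX.indep_past t) ?_
    have hfac : (fun ω u => armNoise ν η e X i t u ω)
        = (fun (x : Fin n × Fin B → ℝ) (u : Fin B) =>
            e * ((x (i, u) - mean ν i) / (η * mean ν i)))
          ∘ fun ω (p : Fin n × Fin B) => X p.1 t p.2 ω := rfl
    rw [hfac, ← MeasurableSpace.comap_comp]
    exact MeasurableSpace.comap_mono (Measurable.comap_le (by fun_prop))
  iIndepFun_round t := by
    have h1 := hX.indep.precomp (g := fun u : Fin B => (i, t, u))
      (fun u v huv => by simpa using huv)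
    exact h1.comp (fun _ x => e * ((x - mean ν i) / (η * mean ν i))) fun _ => by fun_prop
  lintegral_exp_le t u l hl0 hl := by
    refine le_trans (le_of_eq ?_) (hν.lintegral_exp_mul_le i hη hl0 hl he)
    rw [← hX.map_eq i t u, lintegral_map (by fun_prop) ((hX.measurable i t u).mono (ℱ.le _) le_rfl)]
    rfl

lemma observedSum_armNoise (ha : IsATAEmpirical η ℱ X a) (e : ℝ) (i : Fin n) (t : ℕ) (ω : Ω) :
    observedSum (armNoise ν η e X i) (fun t ω => a t ω i) t ω
      = e * ((sampleSum X a i t ω - sampleCount a i t ω * mean ν i) / (η * mean ν i)) := by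
  have hcard (q : ℕ) :
      (Finset.univ.filter (fun u : Fin B => (u : ℕ) < a q ω i)).card = a q ω i := by
    rw [Fin.card_filter_val_lt, min_eq_right (le_of_mem_allocations (ha.optimal q ω).1 i)]
  simp only [observedSum, armNoise, sampleSum, sampleCount]
  simp_rw [← Finset.mul_sum, ← Finset.sum_div, Finset.sum_sub_distrib, Finset.sum_const, hcard]
  simp [Finset.sum_mul]

/-- The event that before round `t` the empirical mean of arm `i` is off by more than the
confidence width in the direction `e`. -/
def failureEvent (ν : Fin n → Measure ℝ) (η e : ℝ) (X : Fin n → ℕ → Fin B → Ω → ℝ)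
    (a : ℕ → Ω → Fin n → ℕ) (i : Fin n) (t : ℕ) : Set Ω :=
  deviationEvent (armNoise ν η e X i) (fun t ω => a t ω i) (Real.log (2 * ((t : ℝ) + 1) ^ 2)) t

lemma mem_failureEvent (ha : IsATAEmpirical η ℱ X a) (e : ℝ) (i : Fin n) (t : ℕ) (ω : Ω) :
    ω ∈ failureEvent ν η e X a i t ↔ 0 < sampleCount a i t ω ∧ confWidth a i t ω < 1 ∧
      sampleCount a i t ω * confWidth a i t ω ≤
        e * ((sampleSum X a i t ω - sampleCount a i t ω * mean ν i) / (η * mean ν i)) := by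
  rw [← observedSum_armNoise ha]
  rfl

lemma confWidth_nonneg (i : Fin n) (t : ℕ) (ω : Ω) : 0 ≤ confWidth a i t ω := by
  have h : 0 ≤ Real.log (2 * ((t : ℝ) + 1) ^ 2) := by
    apply Real.log_nonneg
    have : (0 : ℝ) ≤ t := t.cast_nonneg
    nlinarith
  unfold confWidth
  positivity

/-- Barring a failure, `ŝ ≤ μ (1 + η C) (1 - η C)₊ ≤ μ`. -/
lemma lcb_le_mean (ha : IsATAEmpirical η ℱ X a) (hη : 1 ≤ η) {i : Fin n} (hm : 0 < mean ν i)
    {t : ℕ} {ω : Ω} (h : ω ∉ failureEvent ν η 1 X a i t) : lcb η X a t ω i ≤ mean ν i := by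
  have hC := confWidth_nonneg (a := a) i t ω
  unfold lcb
  rcases le_total (1 - η * confWidth a i t ω) 0 with h0 | h0
  · rw [max_eq_right h0]; simpa using hm.le
  rw [max_eq_left h0]
  rcases Nat.eq_zero_or_pos (sampleCount a i t ω) with hc | hc
  · simpa [empMean, hc] using hm.le
  -- a width of exactly `1` makes the bound `0`
  rcases le_or_gt 1 (confWidth a i t ω) with h1 | h1
  · have : 1 - η * confWidth a i t ω = 0 := by nlinarith
    simpa [this] using hm.le
  rw [mem_failureEvent ha] at h
  have hlt := not_le.1 fun hle => h ⟨hc, h1, hle⟩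
  have hc' : (0 : ℝ) < sampleCount a i t ω := Nat.cast_pos.2 hc
  rw [one_mul, div_lt_iff₀ (by positivity)] at hlt
  have hemp : empMean X a i t ω ≤ mean ν i * (1 + η * confWidth a i t ω) := by
    unfold empMean
    rw [div_le_iff₀ hc']
    linarith
  refine (mul_le_mul_of_nonneg_right hemp h0).trans ?_
  nlinarith [mul_nonneg hm.le (sq_nonneg (η * confWidth a i t ω))]

/-- Barring a failure, `ŝ ≥ μ (1 - η C)₊² ≥ μ (1 - 2 η C)`. An arm without samples has to be excluded:
its width is `0` because of division by zero. -/
lemma mean_mul_le_lcb (ha : IsATAEmpirical η ℱ X a) (hη : 1 ≤ η) {i : Fin n} (hm : 0 < mean ν i)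
    {t : ℕ} {ω : Ω} (hc : 0 < sampleCount a i t ω) (h : ω ∉ failureEvent ν η (-1) X a i t) :
    mean ν i * (1 - 2 * (η * confWidth a i t ω)) ≤ lcb η X a t ω i := by
  have hC := confWidth_nonneg (a := a) i t ω
  unfold lcb
  rcases le_total (1 - η * confWidth a i t ω) 0 with h0 | h0
  · rw [max_eq_right h0, mul_zero]
    nlinarith
  rw [max_eq_left h0]
  rcases le_or_gt 1 (confWidth a i t ω) with h1 | h1
  · have : 1 - η * confWidth a i t ω = 0 := by nlinarith
    rw [this, mul_zero]
    nlinarith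
  rw [mem_failureEvent ha] at h
  have hlt := not_le.1 fun hle => h ⟨hc, h1, hle⟩
  have hc' : (0 : ℝ) < sampleCount a i t ω := Nat.cast_pos.2 hc
  have hlt' : -(sampleCount a i t ω * confWidth a i t ω) <
      (sampleSum X a i t ω - sampleCount a i t ω * mean ν i) / (η * mean ν i) := by linarith
  rw [lt_div_iff₀ (by positivity)] at hlt'
  have hemp : mean ν i * (1 - η * confWidth a i t ω) ≤ empMean X a i t ω := by
    unfold empMean
    rw [le_div_iff₀ hc']
    linarith
  refine le_trans ?_ (mul_le_mul_of_nonneg_right hemp h0)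
  nlinarith [mul_nonneg hm.le (sq_nonneg (η * confWidth a i t ω))]

end Arms


/-! ### The regret bound -/

section Regret

variable {n B : ℕ} {Ω : Type*} {mΩ : MeasurableSpace Ω} {P : Measure Ω} {ν : Fin n → Measure ℝ}
  {α η : ℝ} {ℱ : Filtration ℕ mΩ} {X : Fin n → ℕ → Fin B → Ω → ℝ} {a : ℕ → Ω → Fin n → ℕ}
  {abar : Fin n → ℕ} {κ : Fin n → ℤ}

/-- The threshold on the number of samples of arm `i` beyond which, within `K` rounds and barring
failures of the confidence bounds, the arm cannot cause regret. -/
noncomputable def sampleThreshold (ν : Fin n → Measure ℝ) (η : ℝ) (abar : Fin n → ℕ)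
    (κ : Fin n → ℤ) (K : ℕ) (i : Fin n) : ℝ :=
  64 * η ^ 2 * mean ν i ^ 2 * ((abar i : ℝ) + κ i) ^ 2 * Real.log (2 * (K : ℝ) ^ 2)
    / (((abar i : ℝ) + κ i) * mean ν i - proxyLoss abar (mean ν)) ^ 2

lemma one_le_add_of_isLeast (hm : ∀ i, 0 < mean ν i) {i : Fin n} {k : ℤ}
    (hk : IsLeast {m : ℤ | ((abar i : ℝ) + (m : ℝ)) * mean ν i > proxyLoss abar (mean ν)} k) :
    1 ≤ (abar i : ℝ) + k := by
  have h1 : 0 < ((abar i : ℝ) + (k : ℝ)) * mean ν i :=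
    (proxyLoss_nonneg fun i => (hm i).le).trans_lt hk.1
  have h2 := pos_of_mul_pos_left h1 (hm i).le
  have h3 : (0 : ℤ) < (abar i : ℤ) + k := by exact_mod_cast h2
  exact_mod_cast (show (1 : ℤ) ≤ (abar i : ℤ) + k by omega)

/-- By minimality of `k`, the gap `(ā_i + k) μ_i - ℓ(ā)` is at most `μ_i`. -/
lemma gap_le_of_isLeast {i : Fin n} {k : ℤ}
    (hk : IsLeast {m : ℤ | ((abar i : ℝ) + (m : ℝ)) * mean ν i > proxyLoss abar (mean ν)} k) :
    ((abar i : ℝ) + k) * mean ν i - proxyLoss abar (mean ν) ≤ mean ν i := by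
  have h1 : ¬ ((abar i : ℝ) + ((k - 1 : ℤ) : ℝ)) * mean ν i > proxyLoss abar (mean ν) :=
    fun h => by have := hk.2 h; omega
  push_cast at h1
  linarith

/-- The regret of a round is charged to an over-allocated and under-sampled arm, or to a failure of a
confidence bound. -/
lemma round_regret_le (hn : 0 < n) (hm : ∀ i, 0 < mean ν i) (hη : 1 ≤ η)
    (ha : IsATAEmpirical η ℱ X a) (habar : IsOptimal B (mean ν) abar)
    (hκ : ∀ i, IsLeast {m : ℤ | ((abar i : ℝ) + (m : ℝ)) * mean ν i
      > proxyLoss abar (mean ν)} (κ i))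
    {K t : ℕ} (ht : t < K) (ω : Ω) :
    proxyLoss (a t ω) (mean ν) - proxyLoss abar (mean ν) ≤
      (∑ i, (B * mean ν i - proxyLoss abar (mean ν)) *
        if (abar i : ℝ) + κ i ≤ a t ω i ∧
          (sampleCount a i t ω : ℝ) ≤ sampleThreshold ν η abar κ K i then 1 else 0)
      + (⨆ i, (B * mean ν i - proxyLoss abar (mean ν))) *
        ∑ j, ((failureEvent ν η 1 X a j t).indicator (fun _ => (1 : ℝ)) ω
          + (failureEvent ν η (-1) X a j t).indicator (fun _ => (1 : ℝ)) ω) := by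
  classical
  obtain ⟨i, hi⟩ := exists_eq_proxyLoss hn (a t ω) (mean ν)
  set ℓ := proxyLoss abar (mean ν) with hℓ
  have hℓ0 : 0 ≤ ℓ := proxyLoss_nonneg fun i => (hm i).le
  have hG (j : Fin n) : 0 ≤ B * mean ν j - ℓ :=
    sub_nonneg.2 (habar.proxyLoss_le (fun i => (hm i).le) j)
  have hGmax (j : Fin n) : B * mean ν j - ℓ ≤ ⨆ i, (B * mean ν i - ℓ) :=
    le_ciSup (f := fun i => B * mean ν i - ℓ) (Set.finite_range _).bddAbove j
  have hGi : proxyLoss (a t ω) (mean ν) - ℓ ≤ B * mean ν i - ℓ := by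
    rw [← hi]
    have : (a t ω i : ℝ) ≤ B := by exact_mod_cast le_of_mem_allocations (ha.optimal t ω).1 i
    have := mul_le_mul_of_nonneg_right this (hm i).le
    linarith
  have hind (e : ℝ) (j : Fin n) :
      0 ≤ (failureEvent ν η e X a j t).indicator (fun _ => (1 : ℝ)) ω :=
    Set.indicator_nonneg (fun _ _ => zero_le_one) _
  have hterm (j : Fin n) : 0 ≤ (B * mean ν j - ℓ) *
      if (abar j : ℝ) + κ j ≤ a t ω j ∧
        (sampleCount a j t ω : ℝ) ≤ sampleThreshold ν η abar κ K j then (1 : ℝ) else 0 :=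
    mul_nonneg (hG j) (by split_ifs <;> norm_num)
  have hmax0 : 0 ≤ ⨆ i, (B * mean ν i - ℓ) := (hG i).trans (hGmax i)
  have hsum0 : 0 ≤ ∑ j, (B * mean ν j - ℓ) *
      if (abar j : ℝ) + κ j ≤ a t ω j ∧
        (sampleCount a j t ω : ℝ) ≤ sampleThreshold ν η abar κ K j then (1 : ℝ) else 0 :=
    Finset.sum_nonneg fun j _ => hterm j
  have hfail0 : 0 ≤ ∑ j, ((failureEvent ν η 1 X a j t).indicator (fun _ => (1 : ℝ)) ω
      + (failureEvent ν η (-1) X a j t).indicator (fun _ => (1 : ℝ)) ω) :=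
    Finset.sum_nonneg fun j _ => add_nonneg (hind 1 j) (hind (-1) j)
  by_cases hfail : ∃ j, ω ∈ failureEvent ν η 1 X a j t ∨ ω ∈ failureEvent ν η (-1) X a j t
  · obtain ⟨j, hj⟩ := hfail
    have h1 : 1 ≤ ∑ j, ((failureEvent ν η 1 X a j t).indicator (fun _ => (1 : ℝ)) ω
        + (failureEvent ν η (-1) X a j t).indicator (fun _ => (1 : ℝ)) ω) := by
      refine le_trans ?_ (Finset.single_le_sum
        (fun j _ => add_nonneg (hind 1 j) (hind (-1) j)) (Finset.mem_univ j))
      rcases hj with hj | hj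
      · rw [Set.indicator_of_mem hj]; linarith [hind (-1) j]
      · rw [Set.indicator_of_mem hj]; linarith [hind 1 j]
    nlinarith [hGmax i]
  push Not at hfail
  rcases le_or_gt (proxyLoss (a t ω) (mean ν)) ℓ with hle | hlt
  · nlinarith
  -- no confidence bound fails: the arm attaining the loss is over-allocated and under-sampled
  have hN : (abar i : ℝ) + κ i ≤ a t ω i := by
    have hmem : ((a t ω i : ℤ) - abar i) ∈
        {m : ℤ | ((abar i : ℝ) + (m : ℝ)) * mean ν i > proxyLoss abar (mean ν)} := by
      rw [Set.mem_ofPred_eq]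
      push_cast
      rw [add_sub_cancel, hi]
      exact hlt
    have h1 := (hκ i).2 hmem
    have h2 : (abar i : ℤ) + κ i ≤ a t ω i := by omega
    exact_mod_cast h2
  have hN1 := one_le_add_of_isLeast hm (hκ i)
  have hΔ : 0 < ((abar i : ℝ) + κ i) * mean ν i - ℓ := sub_pos.2 (hκ i).1
  have hL (s : ℕ) (hs : 1 ≤ s) : 0 ≤ Real.log (2 * (s : ℝ) ^ 2) := by
    apply Real.log_nonneg
    have : (1 : ℝ) ≤ s := by exact_mod_cast hs
    nlinarith
  have hM : (sampleCount a i t ω : ℝ) ≤ sampleThreshold ν η abar κ K i := by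
    have hLK := hL K (by omega)
    rcases Nat.eq_zero_or_pos (sampleCount a i t ω) with hc | hc
    · rw [hc, Nat.cast_zero]
      unfold sampleThreshold
      positivity
    have hlcb : lcb η X a t ω i * a t ω i ≤ ℓ := by
      rw [mul_comm]
      exact ((le_proxyLoss _ _ i).trans ((ha.optimal t ω).2 _ habar.1)).trans
        (proxyLoss_mono fun j => lcb_le_mean ha hη (hm j) (hfail j).1)
    have hNs : ((abar i : ℝ) + κ i) * lcb η X a t ω i ≤ ℓ := by
      rcases le_total 0 (lcb η X a t ω i) with h0 | h0
      · nlinarith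
      · nlinarith
    have hLt : 0 ≤ Real.log (2 * ((t : ℝ) + 1) ^ 2) := by
      simpa using hL (t + 1) (by omega)
    refine (sample_le_of_lcb_le (Nat.cast_pos.2 hc) hη (hm i) (by linarith) hℓ0 hLt hΔ
      (mean_mul_le_lcb ha hη (hm i) hc (hfail i).2) hNs).trans ?_
    unfold sampleThreshold
    have htK : (t : ℝ) + 1 ≤ K := by exact_mod_cast ht
    gcongr
  have h1 : B * mean ν i - ℓ ≤ ∑ j, (B * mean ν j - ℓ) *
      if (abar j : ℝ) + κ j ≤ a t ω j ∧
        (sampleCount a j t ω : ℝ) ≤ sampleThreshold ν η abar κ K j then (1 : ℝ) else 0 := by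
    refine le_trans ?_ (Finset.single_le_sum (fun j _ => hterm j) (Finset.mem_univ i))
    rw [if_pos ⟨hN, hM⟩, mul_one]
  have := mul_nonneg hmax0 hfail0
  linarith

/-- The total cost of the rounds in which arm `i` is over-allocated and under-sampled. -/
lemma mul_card_undersampled_le (hm : ∀ i, 0 < mean ν i) (hη : 1 ≤ η)
    (habar : IsOptimal B (mean ν) abar) {i : Fin n}
    (hκ : IsLeast {m : ℤ | ((abar i : ℝ) + (m : ℝ)) * mean ν i
      > proxyLoss abar (mean ν)} (κ i)) {K : ℕ} (hK : 2 ≤ K) (ω : Ω) :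
    (B * mean ν i - proxyLoss abar (mean ν)) *
      (((Finset.range K).filter fun t => (abar i : ℝ) + κ i ≤ a t ω i ∧
        (sampleCount a i t ω : ℝ) ≤ sampleThreshold ν η abar κ K i).card : ℝ)
      ≤ 384 * η ^ 2 * (mean ν i ^ 2 * ((abar i : ℝ) + κ i)
          * (B * mean ν i - proxyLoss abar (mean ν))
          / (((abar i : ℝ) + κ i) * mean ν i - proxyLoss abar (mean ν)) ^ 2) * Real.log K := by
  have hG : 0 ≤ B * mean ν i - proxyLoss abar (mean ν) :=
    sub_nonneg.2 (habar.proxyLoss_le (fun i => (hm i).le) i)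
  have hN1 := one_le_add_of_isLeast hm hκ
  have hΔ : 0 < ((abar i : ℝ) + κ i) * mean ν i - proxyLoss abar (mean ν) := sub_pos.2 hκ.1
  have hΔμ := gap_le_of_isLeast hκ
  have hμ := hm i
  have hK' : (2 : ℝ) ≤ K := by exact_mod_cast hK
  have hlog := log_two_mul_sq_le hK
  have hlog2 : 1 / 2 ≤ Real.log (2 * (K : ℝ) ^ 2) := by
    have h1 : Real.log 2 ≤ Real.log (2 * (K : ℝ) ^ 2) :=
      Real.log_le_log (by norm_num) (by nlinarith)
    linarith [Real.log_two_gt_d9]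
  set N := (abar i : ℝ) + κ i
  set Δ := N * mean ν i - proxyLoss abar (mean ν)
  set G := B * mean ν i - proxyLoss abar (mean ν)
  set Λ := Real.log (2 * (K : ℝ) ^ 2)
  set D := 64 * η ^ 2 * mean ν i ^ 2 * N / Δ ^ 2 with hD
  have hDN : sampleThreshold ν η abar κ K i = D * Λ * N := by
    rw [hD]; unfold sampleThreshold; ring
  -- `Δ ≤ μ_i` makes `D Λ ≥ 1`, which absorbs the additive `1` of the counting bound
  have hD2 : 2 ≤ D := by
    rw [hD, le_div_iff₀ (by positivity)]
    have h1 : Δ ^ 2 ≤ mean ν i ^ 2 := by gcongr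
    have h2 : 1 ≤ η ^ 2 * N := by nlinarith
    nlinarith [mul_le_mul h2 h1 (by positivity) (by positivity)]
  have hcard := mul_card_filter_le (N := N) (M := sampleThreshold ν η abar κ K i)
    (by rw [hDN]; positivity) (by linarith) (fun t => a t ω i) K
  change N * (((Finset.range K).filter fun t => N ≤ a t ω i ∧
    (sampleCount a i t ω : ℝ) ≤ sampleThreshold ν η abar κ K i).card : ℝ) ≤ _ at hcard
  set c : ℝ := (((Finset.range K).filter fun t => N ≤ a t ω i ∧
    (sampleCount a i t ω : ℝ) ≤ sampleThreshold ν η abar κ K i).card : ℝ)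
  rw [hDN] at hcard
  have hc : c ≤ D * Λ + 1 := by
    have : N * c ≤ N * (D * Λ + 1) := by linarith
    exact le_of_mul_le_mul_left this (by linarith)
  have hc2 : c ≤ 2 * D * (3 * Real.log K) := by
    have h1 : 1 ≤ D * Λ := by nlinarith
    have h2 : D * Λ ≤ D * (3 * Real.log K) := by gcongr
    linarith
  calc G * c ≤ G * (2 * D * (3 * Real.log K)) := by gcongr
    _ = _ := by rw [hD]; ring

lemma integrable_proxyLoss [IsFiniteMeasure P] (hm : ∀ i, 0 < mean ν i)
    (ha : IsATAEmpirical η ℱ X a) (t : ℕ) :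
    Integrable (fun ω => proxyLoss (a t ω) (mean ν)) P := by
  have hmeas : Measurable fun ω => proxyLoss (a t ω) (mean ν) :=
    (Measurable.of_discrete (f := fun b : Fin n → ℕ => proxyLoss b (mean ν))).comp
      ((ha.predictable t).mono (ℱ.le t) le_rfl)
  refine Integrable.of_bound hmeas.aestronglyMeasurable (∑ i, B * mean ν i)
    (ae_of_all _ fun ω => ?_)
  rw [Real.norm_of_nonneg (proxyLoss_nonneg fun i => (hm i).le)]
  refine Real.iSup_le (fun i => ?_)
    (Finset.sum_nonneg fun i _ => mul_nonneg (Nat.cast_nonneg _) (hm i).le)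
  have : (a t ω i : ℝ) ≤ B := by exact_mod_cast le_of_mem_allocations (ha.optimal t ω).1 i
  exact (mul_le_mul_of_nonneg_right this (hm i).le).trans
    (Finset.single_le_sum (f := fun i => (B : ℝ) * mean ν i)
      (fun i _ => mul_nonneg (Nat.cast_nonneg _) (hm i).le) (Finset.mem_univ i))

lemma regret_eq_integral [IsProbabilityMeasure P] (hm : ∀ i, 0 < mean ν i)
    (ha : IsATAEmpirical η ℱ X a) (K : ℕ) :
    regret P (mean ν) a abar K = ∫ ω, ∑ t ∈ Finset.range K,
      (proxyLoss (a t ω) (mean ν) - proxyLoss abar (mean ν)) ∂P := by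
  have hsub (t : ℕ) : Integrable
      (fun ω => proxyLoss (a t ω) (mean ν) - proxyLoss abar (mean ν)) P :=
    (integrable_proxyLoss hm ha t).sub (integrable_const _)
  rw [integral_finsetSum _ fun t _ => hsub t]
  simp_rw [fun t => integral_sub (integrable_proxyLoss (P := P) hm ha t)
    (integrable_const (proxyLoss abar (mean ν)))]
  simp [regret]

lemma regret_le_of_two_le [IsProbabilityMeasure P] (hn : 0 < n) (hν : SubExponentialArms ν α)
    (hη : ∀ i, psiOneNorm (ν i) (fun x => x) / ENNReal.ofReal (mean ν i) ≤ ENNReal.ofReal η)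
    (hX : IsSampling P ν ℱ X) (ha : IsATAEmpirical η ℱ X a) (habar : IsOptimal B (mean ν) abar)
    (hκ : ∀ i, IsLeast {m : ℤ | ((abar i : ℝ) + (m : ℝ)) * mean ν i
      > proxyLoss abar (mean ν)} (κ i))
    {K : ℕ} (hK : 2 ≤ K) :
    regret P (mean ν) a abar K
      ≤ 2 * (n : ℝ) * (⨆ i, ((B : ℝ) * mean ν i - proxyLoss abar (mean ν)))
        + 384 * η ^ 2 * (∑ i, mean ν i ^ 2 * ((abar i : ℝ) + (κ i : ℝ))
            * ((B : ℝ) * mean ν i - proxyLoss abar (mean ν))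
            / (((abar i : ℝ) + (κ i : ℝ)) * mean ν i - proxyLoss abar (mean ν)) ^ 2)
          * Real.log K := by
  have hm := hν.mean_pos
  have hη1 := hν.one_le_of_psiOneNorm_div_le ⟨0, hn⟩ (hη _)
  have hmax0 : 0 ≤ ⨆ i, ((B : ℝ) * mean ν i - proxyLoss abar (mean ν)) :=
    Real.iSup_nonneg fun j => sub_nonneg.2 (habar.proxyLoss_le (fun i => (hm i).le) j)
  set G := ⨆ i, ((B : ℝ) * mean ν i - proxyLoss abar (mean ν)) with hG
  set A := 384 * η ^ 2 * (∑ i, mean ν i ^ 2 * ((abar i : ℝ) + (κ i : ℝ))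
            * ((B : ℝ) * mean ν i - proxyLoss abar (mean ν))
            / (((abar i : ℝ) + (κ i : ℝ)) * mean ν i - proxyLoss abar (mean ν)) ^ 2)
          * Real.log K with hA
  have hnoise (j : Fin n) {e : ℝ} (he : e = 1 ∨ e = -1) :=
    isAdaptiveNoise_armNoise hν hX ha j (hη j) he
  have hind (j : Fin n) {e : ℝ} (he : e = 1 ∨ e = -1) (t : ℕ) :
      Integrable ((failureEvent ν η e X a j t).indicator fun _ => (1 : ℝ)) P :=
    (integrable_const 1).indicator ((hnoise j he).measurableSet_deviationEvent _ t)
  have hpair (j : Fin n) (t : ℕ) : Integrable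
      (fun ω => (failureEvent ν η 1 X a j t).indicator (fun _ => (1 : ℝ)) ω
        + (failureEvent ν η (-1) X a j t).indicator (fun _ => (1 : ℝ)) ω) P :=
    (hind j (Or.inl rfl) t).add (hind j (Or.inr rfl) t)
  have hpoint (ω : Ω) : ∑ t ∈ Finset.range K,
      (proxyLoss (a t ω) (mean ν) - proxyLoss abar (mean ν)) ≤
      A + G * ∑ t ∈ Finset.range K, ∑ j,
        ((failureEvent ν η 1 X a j t).indicator (fun _ => (1 : ℝ)) ω
          + (failureEvent ν η (-1) X a j t).indicator (fun _ => (1 : ℝ)) ω) := by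
    refine (Finset.sum_le_sum fun t ht => round_regret_le hn hm hη1 ha habar hκ
      (Finset.mem_range.1 ht) ω).trans ?_
    rw [Finset.sum_add_distrib, ← Finset.mul_sum, Finset.sum_comm]
    gcongr
    rw [hA, Finset.mul_sum, Finset.sum_mul]
    refine Finset.sum_le_sum fun i _ => ?_
    rw [← Finset.mul_sum, Finset.sum_boole]
    exact mul_card_undersampled_le hm hη1 habar (hκ i) hK ω
  have hint : Integrable (fun ω => ∑ t ∈ Finset.range K, ∑ j,
        ((failureEvent ν η 1 X a j t).indicator (fun _ => (1 : ℝ)) ω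
          + (failureEvent ν η (-1) X a j t).indicator (fun _ => (1 : ℝ)) ω)) P :=
    integrable_finsetSum _ fun t _ => integrable_finsetSum _ fun j _ => hpair j t
  have hfail (j : Fin n) {e : ℝ} (he : e = 1 ∨ e = -1) : ∑ t ∈ Finset.range K,
      ∫ ω, (failureEvent ν η e X a j t).indicator (fun _ => (1 : ℝ)) ω ∂P ≤ 1 := by
    refine le_trans (le_of_eq (Finset.sum_congr rfl fun t _ => ?_))
      ((hnoise j he).sum_measureReal_deviationEvent_le K)
    exact integral_indicator_one ((hnoise j he).measurableSet_deviationEvent _ t)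
  have hsum : ∫ ω, ∑ t ∈ Finset.range K, ∑ j,
        ((failureEvent ν η 1 X a j t).indicator (fun _ => (1 : ℝ)) ω
          + (failureEvent ν η (-1) X a j t).indicator (fun _ => (1 : ℝ)) ω) ∂P ≤ 2 * n := by
    rw [integral_finsetSum _ fun t _ => integrable_finsetSum _ fun j _ => hpair j t]
    have h1 (t : ℕ) : ∫ ω, ∑ j, ((failureEvent ν η 1 X a j t).indicator (fun _ => (1 : ℝ)) ω
          + (failureEvent ν η (-1) X a j t).indicator (fun _ => (1 : ℝ)) ω) ∂P
        = ∑ j, (∫ ω, (failureEvent ν η 1 X a j t).indicator (fun _ => (1 : ℝ)) ω ∂P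
          + ∫ ω, (failureEvent ν η (-1) X a j t).indicator (fun _ => (1 : ℝ)) ω ∂P) := by
      rw [integral_finsetSum _ fun j _ => hpair j t]
      exact Finset.sum_congr rfl fun j _ =>
        integral_add (hind j (Or.inl rfl) t) (hind j (Or.inr rfl) t)
    simp_rw [h1]
    rw [Finset.sum_comm]
    calc _ ≤ ∑ _j : Fin n, (2 : ℝ) := Finset.sum_le_sum fun j _ => by
          rw [Finset.sum_add_distrib]
          linarith [hfail j (e := 1) (Or.inl rfl), hfail j (e := -1) (Or.inr rfl)]
      _ = 2 * n := by simp [mul_comm]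
  rw [regret_eq_integral hm ha]
  calc _ ≤ ∫ ω, (A + G * ∑ t ∈ Finset.range K, ∑ j,
        ((failureEvent ν η 1 X a j t).indicator (fun _ => (1 : ℝ)) ω
          + (failureEvent ν η (-1) X a j t).indicator (fun _ => (1 : ℝ)) ω)) ∂P :=
        integral_mono (integrable_finsetSum _ fun t _ =>
            (integrable_proxyLoss hm ha t).sub (integrable_const _))
          ((integrable_const A).add (hint.const_mul G)) hpoint
    _ ≤ A + G * (2 * n) := by
        rw [integral_add (integrable_const A) (hint.const_mul G), integral_const_mul G]
        simp only [integral_const, probReal_univ, one_smul]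
        gcongr
    _ = _ := by ring

/-- A single round costs at most `max_i (B μ_i - ℓ(ā))`. -/
lemma regret_le_of_le_one [IsProbabilityMeasure P] (hn : 0 < n) (hm : ∀ i, 0 < mean ν i)
    (ha : IsATAEmpirical η ℱ X a) (habar : IsOptimal B (mean ν) abar) {K : ℕ} (hK : K ≤ 1) :
    regret P (mean ν) a abar K
      ≤ 2 * (n : ℝ) * (⨆ i, ((B : ℝ) * mean ν i - proxyLoss abar (mean ν))) := by
  have hmax0 : 0 ≤ ⨆ i, ((B : ℝ) * mean ν i - proxyLoss abar (mean ν)) :=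
    Real.iSup_nonneg fun j => sub_nonneg.2 (habar.proxyLoss_le (fun i => (hm i).le) j)
  set G := ⨆ i, ((B : ℝ) * mean ν i - proxyLoss abar (mean ν)) with hG
  have hround (t : ℕ) (ω : Ω) : proxyLoss (a t ω) (mean ν) - proxyLoss abar (mean ν) ≤ G := by
    obtain ⟨i, hi⟩ := exists_eq_proxyLoss hn (a t ω) (mean ν)
    refine le_trans ?_ (le_ciSup (f := fun i => (B : ℝ) * mean ν i - proxyLoss abar (mean ν))
      (Set.finite_range _).bddAbove i)
    have : (a t ω i : ℝ) ≤ B := by exact_mod_cast le_of_mem_allocations (ha.optimal t ω).1 i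
    rw [← hi]
    exact sub_le_sub_right (mul_le_mul_of_nonneg_right this (hm i).le) _
  have hn' : (1 : ℝ) ≤ n := by exact_mod_cast hn
  rw [regret_eq_integral hm ha]
  calc _ ≤ ∫ _ω, G ∂P := by
        refine integral_mono (integrable_finsetSum _ fun t _ =>
          (integrable_proxyLoss hm ha t).sub (integrable_const _)) (integrable_const G) fun ω => ?_
        interval_cases K
        · simpa using hmax0
        · simpa using hround 0 ω
    _ = G := by simp
    _ ≤ 2 * n * G := by nlinarith

end Regret

end ATA

theorem theorem3 :
    ∃ c : ℝ, 0 < c ∧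
      ∀ (n B : ℕ), 0 < n →
      ∀ (ν : Fin n → Measure ℝ) (α : ℝ), ATA.SubExponentialArms ν α →
      ∀ (η : ℝ),
        (⨆ i, ATA.psiOneNorm (ν i) (fun x => x) / ENNReal.ofReal (ATA.mean ν i))
          ≤ ENNReal.ofReal η →
      ∀ (Ω : Type*) (mΩ : MeasurableSpace Ω) (P : Measure Ω), IsProbabilityMeasure P →
      ∀ (ℱ : Filtration ℕ mΩ) (X : Fin n → ℕ → Fin B → Ω → ℝ), ATA.IsSampling P ν ℱ X →
      ∀ (a : ℕ → Ω → Fin n → ℕ), ATA.IsATAEmpirical η ℱ X a →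
      ∀ (abar : Fin n → ℕ), ATA.IsOptimal B (ATA.mean ν) abar →
      ∀ (κ : Fin n → ℤ),
        (∀ i, IsLeast {m : ℤ | ((abar i : ℝ) + (m : ℝ)) * ATA.mean ν i
          > ATA.proxyLoss abar (ATA.mean ν)} (κ i)) →
      ∀ K : ℕ,
        ATA.regret P (ATA.mean ν) a abar K
          ≤ 2 * (n : ℝ) * (⨆ i, ((B : ℝ) * ATA.mean ν i - ATA.proxyLoss abar (ATA.mean ν)))
            + c * η ^ 2 * (∑ i,
                ATA.mean ν i ^ 2 * ((abar i : ℝ) + (κ i : ℝ))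
                    * ((B : ℝ) * ATA.mean ν i - ATA.proxyLoss abar (ATA.mean ν))
                  / (((abar i : ℝ) + (κ i : ℝ)) * ATA.mean ν i
                      - ATA.proxyLoss abar (ATA.mean ν)) ^ 2) * Real.log K := by
  refine ⟨384, by norm_num, ?_⟩
  intro n B hn ν α hν η hη Ω mΩ P hP ℱ X hX a ha abar habar κ hκ K
  have hηi (i : Fin n) : ATA.psiOneNorm (ν i) (fun x => x) / ENNReal.ofReal (ATA.mean ν i)
      ≤ ENNReal.ofReal η :=
    (le_iSup (fun i => ATA.psiOneNorm (ν i) (fun x => x) / ENNReal.ofReal (ATA.mean ν i)) i).trans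
      hη
  rcases le_or_gt K 1 with hK | hK
  · -- `log K = 0` for `K = 1`, and also for `K = 0` by convention
    have hlog : Real.log K = 0 := by interval_cases K <;> simp
    rw [hlog, mul_zero, add_zero]
    exact ATA.regret_le_of_le_one hn hν.mean_pos ha habar hK
  · exact ATA.regret_le_of_two_le hn hν hηi hX ha habar hκ hK
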